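/- Let $(w_n)_{n\ge 1}$ be non-negative real numbers with $w_1>0$, and put $W_n=\sum_{i=1}^n w_i$ and $a_n=\sum_{i=1}^n w_i/W_i$. Let $(T_n)_{n\ge1}$ be the weighted recursive tree with weights $(w_n)_{n\ge1}$: $T_1$ consists of the root, labelled $1$, and $T_{n+1}$ is obtained from $T_n$ by adding a vertex labelled $n+1$ whose parent is, conditionally on $T_n$, the vertex labelled $k$ with probability $w_k/W_n$, for $k=1,\dots,n$. Let $H(T_n)$ be the height of $T_n$, that is, the largest graph distance of a vertex of $T_n$ from the root. Let $\alpha>1$, $\beta>0$ and let $J:[1,\infty)\to(0,\infty)$. If $\beta<\frac12$, assume that $J$ is twice differentiable with $x^iJ^{(i)}(x)/J(x)\to0$ as $x\to\infty$ for $i=1,2$; if $\beta\ge\frac12$, assume that $J$ is measurable with $J(\lambda x)/J(x)\to1$ as $x\to\infty$ for every $\lambda>0$. Assume that $a_n$ converges to a finite limit $a_\infty$ and that, as $n\to\infty$, $$a_\infty-a_n=\exp\bigl(-(\alpha-1)(\log n)^\beta\bigr)\cdot J\bigl(\exp((\log n)^\beta)\bigr)\cdot\Bigl(1+o\bigl((\log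 n)^{\min(4\beta-2,\,0)}\bigr)\Bigr).$$ Then the following hold, where $x_n\sim y_n$ means $x_n=y_n(1+o(1))$. 1. If $\beta\in(0,1)$ and $\sum_{i\ge n}w_i^2/W_i^2=O(1/n)$, then almost surely, as $n\to\infty$, $$H(T_n)\sim\frac{(\log n)^{1-\beta}}{(\alpha-1)(1-\beta)}.$$ 2. If $\beta=1$ and, for every $\varepsilon>0$, $\sum_{i\ge n}w_i^2/W_i^2=O\bigl(n^{-(2\alpha-1-\varepsilon)}\bigr)$, then almost surely, as $n\to\infty$, $$H(T_n)\sim\frac{\log\log n}{\log\alpha}.$$ 3. If $\beta>1$ and, for some $\varepsilon>0$, $\sum_{i\ge n}w_i^2/W_i^2=O\bigl(n^{-\varepsilon}\exp(-2(\alpha-1)(\log n)^\beta)\,J(\exp((\log n)^\beta))^2\bigr)$, then almost surely, as $n\to\infty$, $$H(T_n)\sim\frac{\log\log\log n}{\log\beta}.$$ -/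

import Mathlib

open Filter Topology MeasureTheory ProbabilityTheory Asymptotics

noncomputable section

/-- A growing sequence of rooted trees `T 1 ⊂ T 2 ⊂ ⋯`. The tree `T n` has the vertices with labels
`1, …, n` and the root `1`; `T (n + 1)` is obtained from `T n` by attaching the vertex `n + 1` to
the vertex `parent (n + 1)` of `T n`. (The values `parent 0` and `parent 1` have no meaning and are
never used.) -/
structure GrowingTree where
  parent : ℕ → ℕ
  parent_mem : ∀ n, 1 ≤ n → parent (n + 1) ∈ Finset.Icc 1 n

namespace GrowingTree

/-- The height of the vertex with label `v`: the number of edges between it and the root `1`. -/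
def depth (T : GrowingTree) : ℕ → ℕ
  | 0 => 0
  | 1 => 0
  | v + 2 => depth T (T.parent (v + 2)) + 1
termination_by v => v
decreasing_by
  have h := Finset.mem_Icc.1 (T.parent_mem (v + 1) (by omega))
  have h2 : T.parent (v + 2) ≤ v + 1 := h.2
  omega

/-- The height of the tree `T n`: the largest height of a vertex with label in `1, …, n`. -/
def height (T : GrowingTree) (n : ℕ) : ℕ := (Finset.Icc 1 n).sup T.depth

/-- The tree `T n`, encoded by the parents of its vertices `2, …, n`. -/
def upTo (T : GrowingTree) (n : ℕ) : Finset.Icc 2 n → ℕ := fun i => T.parent i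

end GrowingTree

namespace WRT

/-- `W n = w 1 + ⋯ + w n`. -/
def W (w : ℕ → ℝ) (n : ℕ) : ℝ := ∑ i ∈ Finset.Icc 1 n, w i

/-- `a n = w 1 / W 1 + ⋯ + w n / W n`. -/
def a (w : ℕ → ℝ) (n : ℕ) : ℝ := ∑ i ∈ Finset.Icc 1 n, w i / W w i

/-- The tail `∑_{i ≥ n} w i ^ 2 / W i ^ 2`. The series converges as soon as `a w` does, because
`0 ≤ w i / W i ≤ 1`. -/
def sqTail (w : ℕ → ℝ) (n : ℕ) : ℝ := ∑' j : ℕ, w (n + j) ^ 2 / W w (n + j) ^ 2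

/-- The random sequence of growing trees `T` is a weighted recursive tree with weights
`w 1, w 2, …`: conditionally on `T n`, the parent of the vertex `n + 1` is the vertex `k` with
probability `w k / W n`, for `k = 1, …, n`. -/
structure IsWRT {Ω : Type*} [MeasurableSpace Ω] (μ : Measure Ω) (w : ℕ → ℝ)
    (T : Ω → GrowingTree) : Prop where
  measurable_upTo : ∀ n, Measurable fun ω => (T ω).upTo n
  condProb_parent : ∀ n, 1 ≤ n → ∀ k ∈ Finset.Icc 1 n,
    μ⟦{ω | (T ω).parent (n + 1) = k} | MeasurableSpace.comap (fun ω => (T ω).upTo n) inferInstance⟧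
      =ᵐ[μ] fun _ => w k / W w n

/-- `L`, viewed as a function on `[1, ∞)`, is slowly varying. -/
structure SlowlyVarying (L : ℝ → ℝ) : Prop where
  measurable : Measurable fun x : Set.Ici (1 : ℝ) => L x
  tendsto : ∀ c : ℝ, 0 < c → Tendsto (fun x => L (c * x) / L x) atTop (𝓝 1)

/-- `L`, viewed as a function on `[1, ∞)`, is `k` times differentiable (one-sidedly at `1`), and
`x ^ i * L⁽ⁱ⁾ x / L x → 0` as `x → ∞` for `1 ≤ i ≤ k`. -/
structure SmoothlySlowlyVarying (k : ℕ) (L : ℝ → ℝ) : Prop where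
  differentiableOn : ∀ i, i < k →
    DifferentiableOn ℝ (iteratedDerivWithin i L (Set.Ici 1)) (Set.Ici 1)
  tendsto : ∀ i, 1 ≤ i → i ≤ k →
    Tendsto (fun x => x ^ i * iteratedDerivWithin i L (Set.Ici 1) x / L x) atTop (𝓝 0)

/-- `exp (-(α - 1) log^β n) * J (exp (log^β n))`. -/
def mainTerm (α β : ℝ) (J : ℝ → ℝ) (n : ℕ) : ℝ :=
  Real.exp (-(α - 1) * Real.log n ^ β) * J (Real.exp (Real.log n ^ β))

/-- `a n` converges to some finite limit `a_∞` and
`a_∞ - a n = exp (-(α - 1) log^β n) * J (exp (log^β n)) * (1 + o ((log n) ^ min (4β - 2) 0))`. -/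
def QuicklyConverging (w : ℕ → ℝ) (α β : ℝ) (J : ℝ → ℝ) : Prop :=
  ∃ aInf : ℝ, Tendsto (a w) atTop (𝓝 aInf) ∧
    ∃ r : ℕ → ℝ, r =o[atTop] (fun n : ℕ => Real.log n ^ min (4 * β - 2) 0) ∧
      ∀ n, 1 ≤ n → aInf - a w n = mainTerm α β J n * (1 + r n)

end WRT

end

/-!
Write `A n = a_∞ - a n`, which decays roughly like `exp (-γ (log n) ^ β)` with `γ = α - 1`.

Upper bound: if every given vertex has height `h` with probability at most `exp (-L)` and vertices
of height `h` have labels larger than `s`, then every given vertex has height `h + 1` with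
probability at most `exp (-L) * A s`, because its parent is such a vertex. A union bound allows any
`s` slightly smaller than `exp L`, so one more generation replaces `L` by about `L + γ L ^ β`.

Lower bound: if the vertices of height at least `j` carry a fraction `exp (-L)` of the weight at
time `exp L`, then their children with labels up to `exp (L + γ L ^ β)` gather weight of order
`exp (-L) * A (exp L)`, up to logarithmic factors. An exponential moment estimate, whose variance
term is the tail of `∑ (w i / W i) ^ 2`, shows that at least half of this is gathered with high
probability, so that again `L` is replaced by about `L + γ L ^ β`.

Hence the height of `T n` is asymptotic to the number of steps in which the recursion
`L ↦ L + γ L ^ β` reaches `log n`. This is `Ψ (log n)` for the function `Ψ` that grows by about `1`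
in each step: a multiple of `L ^ (1 - β)` for `β < 1`, of `log L` for `β = 1` and of `log (log L)`
for `β > 1`.
-/

namespace GrowingTree

lemma depth_zero (T : GrowingTree) : T.depth 0 = 0 := by
  rw [depth]

lemma depth_one (T : GrowingTree) : T.depth 1 = 0 := by
  rw [depth]

lemma depth_succ (T : GrowingTree) {n : ℕ} (hn : 1 ≤ n) :
    T.depth (n + 1) = T.depth (T.parent (n + 1)) + 1 := by
  obtain ⟨m, rfl⟩ := Nat.exists_eq_add_of_le' hn
  rw [depth]

lemma one_le_parent (T : GrowingTree) {n : ℕ} (hn : 1 ≤ n) : 1 ≤ T.parent (n + 1) :=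
  (Finset.mem_Icc.1 (T.parent_mem n hn)).1

lemma parent_le (T : GrowingTree) {n : ℕ} (hn : 1 ≤ n) : T.parent (n + 1) ≤ n :=
  (Finset.mem_Icc.1 (T.parent_mem n hn)).2

lemma depth_lt (T : GrowingTree) {n : ℕ} (hn : 1 ≤ n) : T.depth n < n := by
  induction n using Nat.strong_induction_on with
  | _ n ih =>
    rcases hn.eq_or_lt with rfl | hn
    · simp [depth_one]
    · obtain ⟨m, rfl⟩ := Nat.exists_eq_add_of_le' hn.le
      have hm : 1 ≤ m := by omega
      have hparent := T.parent_le hm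
      have hdepth := ih (T.parent (m + 1)) (by omega) (T.one_le_parent hm)
      rw [T.depth_succ hm]
      omega

lemma parent_eq_of_upTo_eq {T T' : GrowingTree} {n i : ℕ} (h : T.upTo n = T'.upTo n)
    (h2i : 2 ≤ i) (hin : i ≤ n) : T.parent i = T'.parent i :=
  congrFun h ⟨i, Finset.mem_Icc.2 ⟨h2i, hin⟩⟩

lemma upTo_eq_of_le {T T' : GrowingTree} {m n : ℕ} (hmn : m ≤ n) (h : T.upTo n = T'.upTo n) :
    T.upTo m = T'.upTo m :=
  funext fun i => parent_eq_of_upTo_eq h (Finset.mem_Icc.1 i.2).1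
    ((Finset.mem_Icc.1 i.2).2.trans hmn)

lemma depth_eq_of_upTo_eq {T T' : GrowingTree} {n v : ℕ} (h : T.upTo n = T'.upTo n)
    (hv : v ≤ n) : T.depth v = T'.depth v := by
  induction v using Nat.strong_induction_on with
  | _ v ih =>
    match v with
    | 0 => simp [depth_zero]
    | 1 => simp [depth_one]
    | v + 2 =>
      have hparent := T.parent_le (n := v + 1) (by omega)
      rw [T.depth_succ (by omega), T'.depth_succ (by omega),
        ← parent_eq_of_upTo_eq h (by omega) hv, ih _ (by omega) (by omega)]

lemma height_le_iff (T : GrowingTree) {n h : ℕ} :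
    T.height n ≤ h ↔ ∀ v, 1 ≤ v → v ≤ n → T.depth v ≤ h := by
  simp [height, Finset.sup_le_iff]

lemma depth_le_height (T : GrowingTree) {n v : ℕ} (hv : 1 ≤ v) (hvn : v ≤ n) :
    T.depth v ≤ T.height n :=
  T.height_le_iff.1 le_rfl v hv hvn

lemma height_mono (T : GrowingTree) : Monotone T.height := fun _ _ hmn =>
  T.height_le_iff.2 fun _ hv hvm => T.depth_le_height hv (hvm.trans hmn)

/-- The total weight of the vertices with label in `(n, m]` whose height is at least `j`; for
`n = 0` these are all such vertices of `T m`. -/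
noncomputable def levelWeight (T : GrowingTree) (w : ℕ → ℝ) (j n m : ℕ) : ℝ :=
  ∑ k ∈ Finset.Ioc n m, if j ≤ T.depth k then w k else 0

section levelWeight

variable (T : GrowingTree) {w : ℕ → ℝ}

lemma levelWeight_succ (w : ℕ → ℝ) (j : ℕ) {n m : ℕ} (h : n ≤ m) :
    T.levelWeight w j n (m + 1)
      = T.levelWeight w j n m + if j ≤ T.depth (m + 1) then w (m + 1) else 0 :=
  Finset.sum_Ioc_succ_top h _

lemma levelWeight_nonneg (hw : ∀ n, 1 ≤ n → 0 ≤ w n) (j n m : ℕ) :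
    0 ≤ T.levelWeight w j n m :=
  Finset.sum_nonneg fun k hk => by
    split_ifs
    exacts [hw k (Nat.one_le_of_lt (Finset.mem_Ioc.1 hk).1), le_rfl]

lemma levelWeight_le_levelWeight (hw : ∀ n, 1 ≤ n → 0 ≤ w n) (j : ℕ) {n n' m m' : ℕ}
    (hn : n' ≤ n) (hm : m ≤ m') : T.levelWeight w j n m ≤ T.levelWeight w j n' m' :=
  Finset.sum_le_sum_of_subset_of_nonneg (Finset.Ioc_subset_Ioc hn hm) fun k hk _ => by
    split_ifs
    exacts [hw k (Nat.one_le_of_lt (Finset.mem_Ioc.1 hk).1), le_rfl]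

lemma levelWeight_zero_zero (w : ℕ → ℝ) (m : ℕ) : T.levelWeight w 0 0 m = WRT.W w m := by
  simp only [levelWeight, WRT.W, zero_le, if_true]
  rfl

lemma le_height_of_levelWeight_pos {j n m : ℕ} (h : 0 < T.levelWeight w j n m) :
    j ≤ T.height m := by
  obtain ⟨k, hk, hne⟩ := Finset.exists_ne_zero_of_sum_ne_zero h.ne'
  rw [Finset.mem_Ioc] at hk
  exact (by_contra fun hj => hne (if_neg hj) : j ≤ T.depth k).trans
    (T.depth_le_height (by omega) hk.2)

lemma levelWeight_eq_of_upTo_eq {T T' : GrowingTree} (w : ℕ → ℝ) (j n : ℕ) {m : ℕ}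
    (h : T.upTo m = T'.upTo m) : T.levelWeight w j n m = T'.levelWeight w j n m :=
  Finset.sum_congr rfl fun k hk => by rw [depth_eq_of_upTo_eq h (Finset.mem_Ioc.1 hk).2]

end levelWeight

/-- The vertex `v` has at least `i` proper ancestors, its `(l + 1)`-th ancestor has a label larger
than `s (i - 1 - l)` for all `l < i`, and its `i`-th ancestor has height at least `h`. A first
moment computation along such chains is possible because each constraint involves one parent. -/
def ConstrainedChain (T : GrowingTree) (h : ℕ) (s : ℕ → ℕ) : ℕ → ℕ → Prop
  | 0, v => h ≤ T.depth v
  | i + 1, v => 2 ≤ v ∧ T.ConstrainedChain h s i (T.parent v) ∧ s i < T.parent v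

lemma ConstrainedChain.of_le_depth {T : GrowingTree} {h : ℕ} {s : ℕ → ℕ}
    (hs : ∀ i v, 1 ≤ v → T.ConstrainedChain h s i v → s i < v) (i : ℕ) :
    ∀ v, 1 ≤ v → h + i ≤ T.depth v → T.ConstrainedChain h s i v := by
  induction i with
  | zero => exact fun _ _ hdepth => hdepth
  | succ i ih =>
    intro v hv hdepth
    obtain ⟨n, rfl⟩ := Nat.exists_eq_add_of_le' hv
    have hn : 1 ≤ n := by
      have := T.depth_lt hv
      omega
    rw [T.depth_succ hn] at hdepth
    have hparent := T.one_le_parent hn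
    have hchain := ih _ hparent (by omega)
    exact ⟨by omega, hchain, hs i _ hparent hchain⟩

lemma constrainedChain_eq_of_upTo_eq {T T' : GrowingTree} {n : ℕ} (hT : T.upTo n = T'.upTo n)
    (h : ℕ) (s : ℕ → ℕ) (i : ℕ) :
    ∀ v ≤ n, T.ConstrainedChain h s i v = T'.ConstrainedChain h s i v := by
  induction i with
  | zero => intro v hv; simp only [ConstrainedChain, depth_eq_of_upTo_eq hT hv]
  | succ i ih =>
    intro v hv
    by_cases h2 : 2 ≤ v
    · obtain ⟨m, rfl⟩ := Nat.exists_eq_add_of_le' (show 1 ≤ v by omega)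
      have hparent := T.parent_le (n := m) (by omega)
      simp only [ConstrainedChain, ← parent_eq_of_upTo_eq hT h2 hv,
        ih (T.parent (m + 1)) (by omega)]
    · simp only [ConstrainedChain, h2, false_and]

end GrowingTree

namespace WRT

section Weights

variable {w : ℕ → ℝ}

lemma W_succ (w : ℕ → ℝ) (n : ℕ) : W w (n + 1) = W w n + w (n + 1) := by
  simp [W, Finset.sum_Icc_succ_top]

lemma a_succ (w : ℕ → ℝ) (n : ℕ) : a w (n + 1) = a w n + w (n + 1) / W w (n + 1) := by
  simp [a, Finset.sum_Icc_succ_top]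

lemma W_one (w : ℕ → ℝ) : W w 1 = w 1 := by simp [W]

lemma W_mono (hw : ∀ n, 1 ≤ n → 0 ≤ w n) : Monotone (W w) :=
  monotone_nat_of_le_succ fun n => by
    rw [W_succ]; linarith [hw (n + 1) (by omega)]

lemma W_pos (hw : ∀ n, 1 ≤ n → 0 ≤ w n) (hw1 : 0 < w 1) {n : ℕ} (hn : 1 ≤ n) : 0 < W w n :=
  (W_one w ▸ hw1 : 0 < W w 1).trans_le (W_mono hw hn)

lemma div_W_nonneg (hw : ∀ n, 1 ≤ n → 0 ≤ w n) {n : ℕ} (hn : 1 ≤ n) : 0 ≤ w n / W w n :=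
  div_nonneg (hw n hn) (Finset.sum_nonneg fun i hi => hw i (Finset.mem_Icc.1 hi).1)

lemma div_W_le_one (hw : ∀ n, 1 ≤ n → 0 ≤ w n) {n : ℕ} (hn : 1 ≤ n) : w n / W w n ≤ 1 :=
  div_le_one_of_le₀
    (Finset.single_le_sum (f := w) (fun i hi => hw i (Finset.mem_Icc.1 hi).1)
      (Finset.mem_Icc.2 ⟨hn, le_rfl⟩))
    (Finset.sum_nonneg fun i hi => hw i (Finset.mem_Icc.1 hi).1)

lemma a_mono (hw : ∀ n, 1 ≤ n → 0 ≤ w n) : Monotone (a w) :=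
  monotone_nat_of_le_succ fun n => by
    rw [a_succ]; linarith [div_W_nonneg hw (n := n + 1) (by omega)]

lemma a_le (hw : ∀ n, 1 ≤ n → 0 ≤ w n) {aInf : ℝ} (ha : Tendsto (a w) atTop (𝓝 aInf)) (n : ℕ) :
    a w n ≤ aInf :=
  (a_mono hw).ge_of_tendsto ha n

lemma a_sub_a (w : ℕ → ℝ) {n m : ℕ} (h : n ≤ m) :
    a w m - a w n = ∑ i ∈ Finset.Ioc n m, w i / W w i := by
  induction m, h using Nat.le_induction with
  | base => simp
  | succ m hm ih => rw [Finset.sum_Ioc_succ_top hm, ← ih, a_succ]; ring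

lemma W_sub_W (w : ℕ → ℝ) {n m : ℕ} (h : n ≤ m) :
    W w m - W w n = ∑ i ∈ Finset.Ioc n m, w i := by
  induction m, h using Nat.le_induction with
  | base => simp
  | succ m hm ih => rw [Finset.sum_Ioc_succ_top hm, ← ih, W_succ]; ring

lemma W_sub_W_div_W_le (hw : ∀ n, 1 ≤ n → 0 ≤ w n) (hw1 : 0 < w 1) {n m : ℕ} (h : n ≤ m) :
    (W w m - W w n) / W w m ≤ a w m - a w n := by
  rw [W_sub_W w h, a_sub_a w h, Finset.sum_div]
  refine Finset.sum_le_sum fun i hi => ?_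
  rw [Finset.mem_Ioc] at hi
  exact div_le_div_of_nonneg_left (hw i (by omega)) (W_pos hw hw1 (by omega)) (W_mono hw hi.2)

lemma exists_W_le_of_tendsto_a (hw : ∀ n, 1 ≤ n → 0 ≤ w n) (hw1 : 0 < w 1) {aInf : ℝ}
    (ha : Tendsto (a w) atTop (𝓝 aInf)) : ∃ K, 0 < K ∧ ∀ n, W w n ≤ K := by
  obtain ⟨n, hn, hn1⟩ := ((ha.eventually_const_lt (show aInf - 1 / 2 < aInf by linarith)).and
    (eventually_ge_atTop 1)).exists
  have hWn := W_pos hw hw1 hn1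
  refine ⟨2 * W w n, by positivity, fun m => ?_⟩
  rcases le_total m n with hmn | hnm
  · linarith [W_mono hw hmn]
  have hincrement := W_sub_W_div_W_le hw hw1 hnm
  rw [div_le_iff₀ (W_pos hw hw1 (hn1.trans hnm))] at hincrement
  nlinarith [a_le hw ha m, W_pos hw hw1 (hn1.trans hnm)]

lemma mul_a_sub_a_le (hw : ∀ n, 1 ≤ n → 0 ≤ w n) (hw1 : 0 < w 1) {n m : ℕ} (h : n ≤ m) :
    w 1 * (a w m - a w n) ≤ ∑ i ∈ Finset.Ioc n m, w i := by
  rw [a_sub_a w h, Finset.mul_sum]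
  refine Finset.sum_le_sum fun i hi => ?_
  have hi1 : 1 ≤ i := Nat.one_le_of_lt (Finset.mem_Ioc.1 hi).1
  rw [mul_div_assoc', div_le_iff₀ (W_pos hw hw1 hi1), mul_comm]
  exact mul_le_mul_of_nonneg_left (W_one w ▸ W_mono hw hi1) (hw i hi1)

lemma summable_sqTail (hw : ∀ n, 1 ≤ n → 0 ≤ w n) {aInf : ℝ}
    (ha : Tendsto (a w) atTop (𝓝 aInf)) {n : ℕ} (hn : 1 ≤ n) :
    Summable fun j : ℕ => w (n + j) ^ 2 / W w (n + j) ^ 2 := by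
  refine summable_of_sum_range_le (c := aInf - a w (n - 1)) (fun j => by positivity) fun m => ?_
  suffices h : ∑ j ∈ Finset.range m, w (n + j) ^ 2 / W w (n + j) ^ 2
      ≤ a w (n - 1 + m) - a w (n - 1) by linarith [a_le hw ha (n - 1 + m)]
  induction m with
  | zero => simp
  | succ m ih =>
    rw [Finset.sum_range_succ, ← add_assoc, a_succ, show n - 1 + m + 1 = n + m by omega]
    have hsq : w (n + m) ^ 2 / W w (n + m) ^ 2 ≤ w (n + m) / W w (n + m) := by
      rw [← div_pow, sq]
      exact mul_le_of_le_one_left (div_W_nonneg hw (by omega)) (div_W_le_one hw (by omega))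
    linarith

lemma sum_Ioc_div_sq_le_sqTail (hw : ∀ n, 1 ≤ n → 0 ≤ w n) {aInf : ℝ}
    (ha : Tendsto (a w) atTop (𝓝 aInf)) {n : ℕ} (hn : 1 ≤ n) (m : ℕ) :
    ∑ i ∈ Finset.Ioc n m, w i ^ 2 / W w i ^ 2 ≤ sqTail w n :=
  calc ∑ i ∈ Finset.Ioc n m, w i ^ 2 / W w i ^ 2
      ≤ ∑ i ∈ Finset.Ico n (n + (m + 1)), w i ^ 2 / W w i ^ 2 := by
        refine Finset.sum_le_sum_of_subset_of_nonneg (fun i hi => ?_) fun _ _ _ => by positivity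
        rw [Finset.mem_Ioc] at hi
        exact Finset.mem_Ico.2 ⟨by omega, by omega⟩
    _ ≤ sqTail w n := by
        rw [Finset.sum_Ico_eq_sum_range, Nat.add_sub_cancel_left]
        exact (summable_sqTail hw ha hn).sum_le_tsum _ fun _ _ => by positivity

lemma sum_Ioc_sq_le (hw : ∀ n, 1 ≤ n → 0 ≤ w n) (hw1 : 0 < w 1) {aInf K : ℝ}
    (ha : Tendsto (a w) atTop (𝓝 aInf)) (hK : ∀ n, W w n ≤ K) {n : ℕ} (hn : 1 ≤ n) (m : ℕ) :
    ∑ i ∈ Finset.Ioc n m, w i ^ 2 ≤ K ^ 2 * sqTail w n := by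
  refine le_trans ?_
    (mul_le_mul_of_nonneg_left (sum_Ioc_div_sq_le_sqTail hw ha hn m) (sq_nonneg K))
  rw [Finset.mul_sum]
  refine Finset.sum_le_sum fun i hi => ?_
  have hWi := W_pos hw hw1 (hn.trans (Finset.mem_Ioc.1 hi).1.le)
  rw [mul_div_assoc', le_div_iff₀ (by positivity), mul_comm]
  exact mul_le_mul_of_nonneg_right (pow_le_pow_left₀ hWi.le (hK i) 2) (sq_nonneg _)

end Weights

section Determined

variable {Ω : Type*} {T : Ω → GrowingTree}

/-- The σ-algebra generated by the tree `T n`. -/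
abbrev treeSigma (T : Ω → GrowingTree) (n : ℕ) : MeasurableSpace Ω :=
  MeasurableSpace.comap (fun ω => (T ω).upTo n) inferInstance

/-- `g` depends on `ω` only through the tree `T n`. As there are countably many trees with `n`
vertices, this is measurability with respect to `treeSigma T n`, for any target. -/
def Determined {E : Type*} (T : Ω → GrowingTree) (n : ℕ) (g : Ω → E) : Prop :=
  Function.FactorsThrough g fun ω => (T ω).upTo n

lemma Determined.mono {E : Type*} {g : Ω → E} {m n : ℕ} (h : m ≤ n) (hg : Determined T m g) :
    Determined T n g :=
  fun _ _ hT => hg (GrowingTree.upTo_eq_of_le h hT)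

lemma Determined.comp₂ {E F G : Type*} {f : Ω → E} {g : Ω → F} {n : ℕ} (hf : Determined T n f)
    (hg : Determined T n g) (φ : E → F → G) : Determined T n fun ω => φ (f ω) (g ω) :=
  fun _ _ hT => congrArg₂ φ (hf hT) (hg hT)

open Classical in
lemma Determined.indicator_one {p : Ω → Prop} {n : ℕ} (hp : Determined T n p) :
    Determined T n ({ω | p ω}.indicator (1 : Ω → ℝ)) :=
  fun _ _ hT => if_congr (iff_of_eq (hp hT)) rfl rfl

lemma determined_depth {v n : ℕ} (h : v ≤ n) : Determined T n fun ω => (T ω).depth v :=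
  fun _ _ hT => GrowingTree.depth_eq_of_upTo_eq hT h

lemma determined_levelWeight (T : Ω → GrowingTree) (w : ℕ → ℝ) (j n m : ℕ) :
    Determined T m fun ω => (T ω).levelWeight w j n m :=
  fun _ _ hT => GrowingTree.levelWeight_eq_of_upTo_eq w j n hT

lemma determined_comp_parent {E : Type*} {n : ℕ} (hn : 1 ≤ n) {Y : ℕ → Ω → E}
    (hY : ∀ k ∈ Finset.Icc 1 n, Determined T n (Y k)) :
    Determined T (n + 1) fun ω => Y ((T ω).parent (n + 1)) ω := fun ω ω' hT => by
  simp only [← GrowingTree.parent_eq_of_upTo_eq hT (show 2 ≤ n + 1 by omega) le_rfl]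
  exact (hY _ ((T ω).parent_mem n hn)).mono n.le_succ hT

lemma Determined.measurable_treeSigma {E : Type*} [MeasurableSpace E] {g : Ω → E} {n : ℕ}
    (hg : Determined T n g) : Measurable[treeSigma T n] g := by
  intro s _
  refine ⟨(fun ω => (T ω).upTo n) '' (g ⁻¹' s), (Set.to_countable _).measurableSet, ?_⟩
  ext ω
  refine ⟨?_, fun hω => ⟨ω, hω, rfl⟩⟩
  rintro ⟨ω', hω', hT⟩
  rwa [Set.mem_preimage, ← hg hT]

variable [MeasurableSpace Ω] {μ : Measure Ω} {w : ℕ → ℝ}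

lemma Determined.measurable (hT : IsWRT μ w T) {E : Type*} [MeasurableSpace E] {g : Ω → E} {n : ℕ}
    (hg : Determined T n g) : Measurable g :=
  hg.measurable_treeSigma.mono (hT.measurable_upTo n).comap_le le_rfl

lemma Determined.measurableSet (hT : IsWRT μ w T) {n : ℕ} {p : Ω → Prop}
    (hp : Determined T n p) : MeasurableSet {ω | p ω} :=
  measurableSet_setOfPred.2 (hp.measurable hT)

lemma Determined.integrable [IsFiniteMeasure μ] (hT : IsWRT μ w T) {g : Ω → ℝ} {n : ℕ}
    (hg : Determined T n g) {C : ℝ} (hC : ∀ ω, |g ω| ≤ C) : Integrable g μ :=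
  Integrable.of_bound (hg.measurable hT).aestronglyMeasurable C (ae_of_all _ hC)

end Determined

section ParentLaw

variable {Ω : Type*} [MeasurableSpace Ω] {μ : Measure Ω} [IsFiniteMeasure μ]
  {w : ℕ → ℝ} {T : Ω → GrowingTree}

lemma integral_mul_indicator_parent (hT : IsWRT μ w T) {n k : ℕ} (hn : 1 ≤ n)
    (hk : k ∈ Finset.Icc 1 n) {g : Ω → ℝ} (hg : Determined T n g) {C : ℝ}
    (hC : ∀ ω, |g ω| ≤ C) :
    ∫ ω, g ω * {ω | (T ω).parent (n + 1) = k}.indicator (fun _ => (1 : ℝ)) ω ∂μ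
      = w k / W w n * ∫ ω, g ω ∂μ := by
  set f := {ω | (T ω).parent (n + 1) = k}.indicator (fun _ => (1 : ℝ))
  have hset : MeasurableSet {ω | (T ω).parent (n + 1) = k} :=
    (determined_comp_parent hn (Y := fun i _ => i = k) fun _ _ _ _ _ => rfl).measurableSet hT
  have hf : Integrable f μ := (integrable_const 1).indicator hset
  have hgf : Integrable (g * f) μ :=
    hf.bdd_mul (hg.measurable hT).aestronglyMeasurable (ae_of_all _ hC)
  have hpull : μ[g * f|treeSigma T n] =ᵐ[μ] g * μ[f|treeSigma T n] :=
    condExp_mul_of_stronglyMeasurable_left hg.measurable_treeSigma.stronglyMeasurable hgf hf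
  calc ∫ ω, (g * f) ω ∂μ = ∫ ω, (μ[g * f|treeSigma T n]) ω ∂μ :=
        (integral_condExp (hT.measurable_upTo n).comap_le).symm
    _ = ∫ ω, w k / W w n * g ω ∂μ := by
        refine integral_congr_ae ?_
        filter_upwards [hpull, hT.condProb_parent n hn k hk] with ω hω hparent
        rw [hω, Pi.mul_apply, hparent, mul_comm]
    _ = w k / W w n * ∫ ω, g ω ∂μ := integral_const_mul _ _

lemma integral_comp_parent (hT : IsWRT μ w T) {n : ℕ} (hn : 1 ≤ n) {Y : ℕ → Ω → ℝ}
    (hY : ∀ k ∈ Finset.Icc 1 n, Determined T n (Y k)) {C : ℝ} (hC : ∀ k ω, |Y k ω| ≤ C) :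
    ∫ ω, Y ((T ω).parent (n + 1)) ω ∂μ
      = ∑ k ∈ Finset.Icc 1 n, w k / W w n * ∫ ω, Y k ω ∂μ := by
  have hsplit : ∀ ω, Y ((T ω).parent (n + 1)) ω = ∑ k ∈ Finset.Icc 1 n,
      Y k ω * {ω | (T ω).parent (n + 1) = k}.indicator (fun _ => (1 : ℝ)) ω := fun ω => by
    rw [Finset.sum_eq_single_of_mem _ ((T ω).parent_mem n hn)]
    · simp
    · intro k _ hk
      simp [Set.indicator, hk.symm]
  simp_rw [hsplit]
  rw [integral_finsetSum]
  · exact Finset.sum_congr rfl fun k hk => integral_mul_indicator_parent hT hn hk (hY k hk) (hC k)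
  · intro k hk
    have hset : MeasurableSet {ω | (T ω).parent (n + 1) = k} :=
      (determined_comp_parent hn (Y := fun i _ => i = k) fun _ _ _ _ _ => rfl).measurableSet hT
    exact ((integrable_const 1).indicator hset).bdd_mul
      ((hY k hk).measurable hT).aestronglyMeasurable (ae_of_all _ (hC k))

lemma measureReal_comp_parent (hT : IsWRT μ w T) {n : ℕ} (hn : 1 ≤ n) {p : ℕ → Ω → Prop}
    (hp : ∀ k ∈ Finset.Icc 1 n, Determined T n (p k)) :
    μ.real {ω | p ((T ω).parent (n + 1)) ω}
      = ∑ k ∈ Finset.Icc 1 n, w k / W w n * μ.real {ω | p k ω} := by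
  have hindicator := integral_comp_parent hT hn (C := 1)
    (Y := fun k => {ω | p k ω}.indicator (1 : Ω → ℝ))
    (fun k hk => (hp k hk).indicator_one)
    (fun k ω => by by_cases h : p k ω <;> simp [Set.indicator, h])
  change ∫ ω, {ω | p ((T ω).parent (n + 1)) ω}.indicator (1 : Ω → ℝ) ω ∂μ = _ at hindicator
  rw [← integral_indicator_one ((determined_comp_parent hn hp).measurableSet hT), hindicator]
  exact Finset.sum_congr rfl fun k hk => by
    rw [integral_indicator_one ((hp k hk).measurableSet hT)]

lemma measureReal_comp_parent_le (hT : IsWRT μ w T) (hw : ∀ n, 1 ≤ n → 0 ≤ w n) (hw1 : 0 < w 1)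
    {aInf : ℝ} (ha : Tendsto (a w) atTop (𝓝 aInf)) {n : ℕ} (hn : 1 ≤ n) {p : ℕ → Ω → Prop}
    (hp : ∀ k, 1 ≤ k → Determined T k (p k)) {s : ℕ} (hs : ∀ k ω, 1 ≤ k → p k ω → s < k) {Q : ℝ}
    (hQ0 : 0 ≤ Q) (hQ : ∀ k, 1 ≤ k → μ.real {ω | p k ω} ≤ Q) :
    μ.real {ω | p ((T ω).parent (n + 1)) ω} ≤ Q * (aInf - a w s) := by
  have hterm : ∀ k ∈ Finset.Icc 1 n, w k / W w n * μ.real {ω | p k ω}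
      ≤ if s < k then Q * (w k / W w k) else 0 := fun k hk => by
    rw [Finset.mem_Icc] at hk
    split_ifs with hsk
    · rw [mul_comm]
      exact mul_le_mul (hQ k hk.1)
        (div_le_div_of_nonneg_left (hw k hk.1) (W_pos hw hw1 hk.1) (W_mono hw hk.2))
        (div_nonneg (hw k hk.1) (W_pos hw hw1 hn).le) hQ0
    · have hempty : {ω | p k ω} = ∅ :=
        Set.eq_empty_of_forall_notMem fun ω hω => hsk (hs k ω hk.1 hω)
      simp [hempty]
  have hfilter : (Finset.Icc 1 n).filter (fun k => s < k) = Finset.Ioc s n := by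
    ext k; simp only [Finset.mem_filter, Finset.mem_Icc, Finset.mem_Ioc]; omega
  calc μ.real {ω | p ((T ω).parent (n + 1)) ω}
      = ∑ k ∈ Finset.Icc 1 n, w k / W w n * μ.real {ω | p k ω} :=
        measureReal_comp_parent hT hn fun k hk =>
          (hp k (Finset.mem_Icc.1 hk).1).mono (Finset.mem_Icc.1 hk).2
    _ ≤ Q * ∑ k ∈ Finset.Ioc s n, w k / W w k := by
        refine (Finset.sum_le_sum hterm).trans_eq ?_
        rw [← Finset.sum_filter, hfilter, Finset.mul_sum]
    _ ≤ Q * (aInf - a w s) := by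
        refine mul_le_mul_of_nonneg_left ?_ hQ0
        rcases le_total s n with hsn | hns
        · rw [← a_sub_a w hsn]; linarith [a_le hw ha n]
        · rw [Finset.Ioc_eq_empty (by omega), Finset.sum_empty]; linarith [a_le hw ha s]

end ParentLaw

section FirstMoment

variable {Ω : Type*} [MeasurableSpace Ω] {μ : Measure Ω} {w : ℕ → ℝ} {T : Ω → GrowingTree}
  {aInf : ℝ}

lemma measureReal_add_le_depth_le [IsProbabilityMeasure μ] (hT : IsWRT μ w T)
    (hw : ∀ n, 1 ≤ n → 0 ≤ w n) (hw1 : 0 < w 1) (ha : Tendsto (a w) atTop (𝓝 aInf))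
    (s i : ℕ) : ∀ v, 1 ≤ v → μ.real {ω | s + i ≤ (T ω).depth v} ≤ (aInf - a w s) ^ i := by
  have hA : 0 ≤ aInf - a w s := sub_nonneg.2 (a_le hw ha s)
  induction i with
  | zero => intro v _; simp
  | succ i ih =>
    intro v hv
    obtain ⟨n, rfl⟩ := Nat.exists_eq_add_of_le' hv
    rcases Nat.eq_zero_or_pos n with rfl | hn
    · have hempty : {ω | s + (i + 1) ≤ (T ω).depth (0 + 1)} = ∅ :=
        Set.eq_empty_of_forall_notMem fun ω hω => by
          simp only [Set.mem_ofPred_eq, zero_add, GrowingTree.depth_one] at hω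
          omega
      rw [hempty, measureReal_empty]
      positivity
    have hparent : {ω | s + (i + 1) ≤ (T ω).depth (n + 1)}
        = {ω | s + i ≤ (T ω).depth ((T ω).parent (n + 1))} := by
      ext ω
      simp only [Set.mem_ofPred_eq, (T ω).depth_succ hn]
      omega
    rw [hparent, pow_succ]
    refine measureReal_comp_parent_le hT hw hw1 ha hn (p := fun k ω => s + i ≤ (T ω).depth k)
      (fun k _ ω ω' hω => by simp only [determined_depth le_rfl hω])
      (fun k ω hk hdepth => ?_) (by positivity) ih
    have := (T ω).depth_lt hk
    omega

lemma exists_forall_measureReal_le_depth_le [IsProbabilityMeasure μ] (hT : IsWRT μ w T)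
    (hw : ∀ n, 1 ≤ n → 0 ≤ w n) (hw1 : 0 < w 1) (ha : Tendsto (a w) atTop (𝓝 aInf))
    {η : ℝ} (hη : 0 < η) : ∃ h : ℕ, ∀ v, 1 ≤ v → μ.real {ω | h ≤ (T ω).depth v} ≤ η := by
  obtain ⟨s, hs⟩ := (ha.eventually_const_lt (show aInf - 1 / 2 < aInf by linarith)).exists
  obtain ⟨i, hi⟩ := exists_pow_lt_of_lt_one hη (show (1 / 2 : ℝ) < 1 by norm_num)
  refine ⟨s + i, fun v hv => (measureReal_add_le_depth_le hT hw hw1 ha s i v hv).trans ?_⟩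
  exact (pow_le_pow_left₀ (sub_nonneg.2 (a_le hw ha s)) (by linarith) i).trans hi.le

variable {h : ℕ} {s : ℕ → ℕ} {Q : ℕ → ℝ}

lemma measureReal_constrainedChain_le [IsFiniteMeasure μ] (hT : IsWRT μ w T)
    (hw : ∀ n, 1 ≤ n → 0 ≤ w n) (hw1 : 0 < w 1) (ha : Tendsto (a w) atTop (𝓝 aInf))
    (hQ : ∀ i, 0 ≤ Q i) (hzero : ∀ v, 1 ≤ v → μ.real {ω | h ≤ (T ω).depth v} ≤ Q 0)
    (hsucc : ∀ i, Q i * (aInf - a w (s i)) ≤ Q (i + 1)) (i : ℕ) :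
    ∀ v, 1 ≤ v → μ.real {ω | (T ω).ConstrainedChain h s i v} ≤ Q i := by
  induction i with
  | zero => exact hzero
  | succ i ih =>
    intro v hv
    obtain ⟨n, rfl⟩ := Nat.exists_eq_add_of_le' hv
    rcases Nat.eq_zero_or_pos n with rfl | hn
    · have hempty : {ω | (T ω).ConstrainedChain h s (i + 1) (0 + 1)} = ∅ :=
        Set.eq_empty_of_forall_notMem fun ω hω => by simpa using hω.1
      rw [hempty, measureReal_empty]
      exact hQ (i + 1)
    have hparent := measureReal_comp_parent_le hT hw hw1 ha hn (s := s i)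
      (p := fun k ω => (T ω).ConstrainedChain h s i k ∧ s i < k)
      (fun k _ ω ω' hω => by
        simp only [GrowingTree.constrainedChain_eq_of_upTo_eq hω h s i k le_rfl])
      (fun k ω _ hω => hω.2) (hQ i)
      (fun k hk => (measureReal_mono fun ω hω => hω.1).trans (ih k hk))
    exact (measureReal_mono fun ω hω => hω.2).trans (hparent.trans (hsucc i))

theorem measure_not_forall_lt_of_le_depth_le [IsFiniteMeasure μ] (hT : IsWRT μ w T)
    (hw : ∀ n, 1 ≤ n → 0 ≤ w n) (hw1 : 0 < w 1) (ha : Tendsto (a w) atTop (𝓝 aInf))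
    (hQ : ∀ i, 0 ≤ Q i) (hzero : ∀ v, 1 ≤ v → μ.real {ω | h ≤ (T ω).depth v} ≤ Q 0)
    (hsucc : ∀ i, Q i * (aInf - a w (s i)) ≤ Q (i + 1)) :
    μ {ω | ¬ ∀ i v, 1 ≤ v → h + i ≤ (T ω).depth v → s i < v}
      ≤ ∑' i, ENNReal.ofReal (s i * Q i) := by
  have hsub : {ω | ¬ ∀ i v, 1 ≤ v → h + i ≤ (T ω).depth v → s i < v} ⊆
      ⋃ i, ⋃ v ∈ Finset.Icc 1 (s i), {ω | (T ω).ConstrainedChain h s i v} := by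
    intro ω hω
    by_contra hchain
    simp only [Set.mem_iUnion, Set.mem_ofPred_eq, not_exists, Finset.mem_Icc] at hchain
    have hs : ∀ i v, 1 ≤ v → (T ω).ConstrainedChain h s i v → s i < v := fun i v hv hc =>
      not_le.1 fun hle => hchain i v ⟨hv, hle⟩ hc
    exact hω fun i v hv hd => hs i v hv (GrowingTree.ConstrainedChain.of_le_depth hs i v hv hd)
  refine (measure_mono hsub).trans ((measure_iUnion_le _).trans (ENNReal.tsum_le_tsum fun i => ?_))
  calc μ (⋃ v ∈ Finset.Icc 1 (s i), {ω | (T ω).ConstrainedChain h s i v})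
      ≤ ∑ v ∈ Finset.Icc 1 (s i), μ {ω | (T ω).ConstrainedChain h s i v} :=
        measure_biUnion_finset_le _ _
    _ ≤ ∑ _v ∈ Finset.Icc 1 (s i), ENNReal.ofReal (Q i) := Finset.sum_le_sum fun v hv => by
        rw [← ofReal_measureReal]
        exact ENNReal.ofReal_le_ofReal (measureReal_constrainedChain_le hT hw hw1 ha hQ hzero hsucc
          i v (Finset.mem_Icc.1 hv).1)
    _ = ENNReal.ofReal (s i * Q i) := by
        rw [Finset.sum_const, Nat.card_Icc, Nat.add_sub_cancel, nsmul_eq_mul,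
          ENNReal.ofReal_mul (by positivity), ENNReal.ofReal_natCast]

end FirstMoment

section ExponentialMoment

variable {Ω : Type*} [MeasurableSpace Ω] {μ : Measure Ω} {w : ℕ → ℝ} {T : Ω → GrowingTree}

lemma exp_neg_le_one_sub_add_sq {x : ℝ} (hx : 0 ≤ x) : Real.exp (-x) ≤ 1 - (x - x ^ 2 / 2) := by
  rw [Real.exp_neg]
  refine (inv_anti₀ (by positivity) (Real.quadratic_le_exp_of_nonneg hx)).trans ?_
  rw [inv_le_iff_one_le_mul₀ (by positivity)]
  nlinarith [sq_nonneg (x ^ 2)]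

lemma sum_div_W_mul_ite_depth (T : GrowingTree) {n : ℕ} (hW : W w n ≠ 0) (j : ℕ) (z : ℝ) :
    ∑ k ∈ Finset.Icc 1 n, w k / W w n * (if j ≤ T.depth k then z else 1)
      = 1 - (1 - z) * (T.levelWeight w j 0 n / W w n) := by
  have hsum : W w n - (1 - z) * T.levelWeight w j 0 n
      = ∑ k ∈ Finset.Icc 1 n, w k * (if j ≤ T.depth k then z else 1) := by
    rw [W, GrowingTree.levelWeight, ← Finset.Icc_add_one_left_eq_Ioc, zero_add, Finset.mul_sum,
      ← Finset.sum_sub_distrib]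
    refine Finset.sum_congr rfl fun k _ => ?_
    split_ifs <;> ring
  rw [mul_div_assoc', one_sub_div hW, hsum, Finset.sum_div]
  exact Finset.sum_congr rfl fun k _ => div_mul_eq_mul_div _ _ _

lemma integral_mul_ite_depth_parent_le [IsFiniteMeasure μ] (hT : IsWRT μ w T) {n : ℕ} (hn : 1 ≤ n)
    (hW : 0 < W w n) {g : Ω → ℝ} (hg : Determined T n g) (hg0 : ∀ ω, 0 ≤ g ω) {C : ℝ}
    (hgC : ∀ ω, g ω ≤ C) {j : ℕ} {q : ℝ}
    (hq : ∀ ω, g ω ≠ 0 → q * W w n ≤ (T ω).levelWeight w j 0 n) {z : ℝ} (hz0 : 0 ≤ z)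
    (hz1 : z ≤ 1) :
    ∫ ω, g ω * (if j ≤ (T ω).depth ((T ω).parent (n + 1)) then z else 1) ∂μ
      ≤ (1 - (1 - z) * q) * ∫ ω, g ω ∂μ := by
  set Y : ℕ → Ω → ℝ := fun k ω => g ω * (if j ≤ (T ω).depth k then z else 1) with hY
  have hYdet : ∀ k ∈ Finset.Icc 1 n, Determined T n (Y k) := fun k hk =>
    hg.comp₂ (determined_depth (Finset.mem_Icc.1 hk).2) fun x d => x * (if j ≤ d then z else 1)
  have hYbdd : ∀ k ω, |Y k ω| ≤ C := fun k ω => by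
    rw [abs_of_nonneg (mul_nonneg (hg0 ω) (by split_ifs <;> positivity))]
    exact (mul_le_of_le_one_right (hg0 ω) (by split_ifs <;> simp [hz1])).trans (hgC ω)
  have hYint : ∀ k ∈ Finset.Icc 1 n, Integrable (fun ω => w k / W w n * Y k ω) μ :=
    fun k hk => ((hYdet k hk).integrable hT (hYbdd k)).const_mul _
  have hgint : Integrable g μ :=
    hg.integrable hT (C := C) fun ω => by rw [abs_of_nonneg (hg0 ω)]; exact hgC ω
  calc ∫ ω, Y ((T ω).parent (n + 1)) ω ∂μ
      = ∫ ω, ∑ k ∈ Finset.Icc 1 n, w k / W w n * Y k ω ∂μ := by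
        rw [integral_comp_parent hT hn hYdet hYbdd, integral_finsetSum _ hYint]
        exact Finset.sum_congr rfl fun k _ => (integral_const_mul _ _).symm
    _ ≤ ∫ ω, (1 - (1 - z) * q) * g ω ∂μ := by
        refine integral_mono (integrable_finsetSum _ hYint) (hgint.const_mul _) fun ω => ?_
        simp only [hY, mul_left_comm _ (g ω), ← Finset.mul_sum,
          sum_div_W_mul_ite_depth (T ω) hW.ne' j z]
        rcases eq_or_ne (g ω) 0 with hzero | hne
        · simp [hzero]
        rw [mul_comm]
        refine mul_le_mul_of_nonneg_right (sub_le_sub_left ?_ 1) (hg0 ω)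
        exact mul_le_mul_of_nonneg_left ((le_div_iff₀ hW).2 (hq ω hne)) (sub_nonneg.2 hz1)
    _ = (1 - (1 - z) * q) * ∫ ω, g ω ∂μ := integral_const_mul _ _

lemma integral_mul_exp_neg_levelWeight_le [IsFiniteMeasure μ] (hT : IsWRT μ w T)
    (hw : ∀ n, 1 ≤ n → 0 ≤ w n) (hw1 : 0 < w 1) {K : ℝ} (hK : ∀ n, W w n ≤ K) {s j : ℕ}
    (hs : 1 ≤ s) {g : Ω → ℝ} (hg : Determined T s g) (hg0 : ∀ ω, 0 ≤ g ω) {C : ℝ}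
    (hgC : ∀ ω, g ω ≤ C) {q : ℝ} (hq0 : 0 ≤ q)
    (hq : ∀ ω, g ω ≠ 0 → q * K ≤ (T ω).levelWeight w j 0 s) {c : ℝ} (hc : 0 ≤ c) {m : ℕ}
    (hm : s ≤ m) :
    ∫ ω, g ω * Real.exp (-(c * (T ω).levelWeight w (j + 1) s m)) ∂μ
      ≤ Real.exp (-(q * (c * ∑ i ∈ Finset.Ioc s m, w i
          - c ^ 2 / 2 * ∑ i ∈ Finset.Ioc s m, w i ^ 2))) * ∫ ω, g ω ∂μ := by
  induction m, hm using Nat.le_induction with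
  | base => simp [GrowingTree.levelWeight]
  | succ n hn ih =>
    have hn1 : 1 ≤ n := hs.trans hn
    set f : Ω → ℝ := fun ω => g ω * Real.exp (-(c * (T ω).levelWeight w (j + 1) s n)) with hf
    set x := c * w (n + 1) with hx
    have hx0 : 0 ≤ x := mul_nonneg hc (hw _ (by omega))
    have hf0 : ∀ ω, 0 ≤ f ω := fun ω => mul_nonneg (hg0 ω) (Real.exp_pos _).le
    have hfC : ∀ ω, f ω ≤ C := fun ω => (mul_le_of_le_one_right (hg0 ω) (Real.exp_le_one_iff.2
      (neg_nonpos.2 (mul_nonneg hc ((T ω).levelWeight_nonneg hw _ _ _))))).trans (hgC ω)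
    have hfdet : Determined T n f :=
      (hg.mono hn).comp₂ (determined_levelWeight T w (j + 1) s n) fun y u => y * Real.exp (-(c * u))
    have hstep := integral_mul_ite_depth_parent_le hT hn1 (W_pos hw hw1 hn1) hfdet hf0 hfC (j := j)
      (q := q) (fun ω hω => ((mul_le_mul_of_nonneg_left (hK n) hq0).trans
        (hq ω (left_ne_zero_of_mul hω))).trans ((T ω).levelWeight_le_levelWeight hw j le_rfl hn))
      (Real.exp_pos (-x)).le (Real.exp_le_one_iff.2 (neg_nonpos.2 hx0))
    have hfactor : 1 - (1 - Real.exp (-x)) * q ≤ Real.exp (-(q * (x - x ^ 2 / 2))) := by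
      nlinarith [exp_neg_le_one_sub_add_sq hx0, Real.add_one_le_exp (-(q * (x - x ^ 2 / 2)))]
    calc ∫ ω, g ω * Real.exp (-(c * (T ω).levelWeight w (j + 1) s (n + 1))) ∂μ
        = ∫ ω, f ω * (if j ≤ (T ω).depth ((T ω).parent (n + 1)) then Real.exp (-x) else 1) ∂μ := by
          congr 1 with ω
          simp only [hf, (T ω).levelWeight_succ w _ hn, (T ω).depth_succ hn1, add_le_add_iff_right]
          split_ifs
          · rw [mul_assoc, ← Real.exp_add, hx]; congr 2; ring
          · simp
      _ ≤ Real.exp (-(q * (x - x ^ 2 / 2))) * ∫ ω, f ω ∂μ :=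
          hstep.trans (mul_le_mul_of_nonneg_right hfactor (integral_nonneg hf0))
      _ ≤ Real.exp (-(q * (x - x ^ 2 / 2))) * _ :=
          mul_le_mul_of_nonneg_left ih (Real.exp_pos _).le
      _ = _ := by
          rw [← mul_assoc, ← Real.exp_add, Finset.sum_Ioc_succ_top hn, Finset.sum_Ioc_succ_top hn]
          congr 2
          ring

variable [IsProbabilityMeasure μ]

lemma measureReal_levelWeight_le_le_exp (hT : IsWRT μ w T) (hw : ∀ n, 1 ≤ n → 0 ≤ w n)
    (hw1 : 0 < w 1) {K : ℝ} (hK : ∀ n, W w n ≤ K) {s j : ℕ} (hs : 1 ≤ s) {q : ℝ} (hq : 0 ≤ q)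
    {m : ℕ} (hm : s ≤ m) {c : ℝ} (hc : 0 ≤ c) (x : ℝ) :
    μ.real {ω | q * K ≤ (T ω).levelWeight w j 0 s ∧ (T ω).levelWeight w (j + 1) s m ≤ x}
      ≤ Real.exp (c * x - q * (c * ∑ i ∈ Finset.Ioc s m, w i
          - c ^ 2 / 2 * ∑ i ∈ Finset.Ioc s m, w i ^ 2)) := by
  set E : Set Ω := {ω | q * K ≤ (T ω).levelWeight w j 0 s}
  set f : Ω → ℝ := fun ω =>
    E.indicator 1 ω * Real.exp (-(c * (T ω).levelWeight w (j + 1) s m)) with hf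
  have hpast : Determined T s fun ω => q * K ≤ (T ω).levelWeight w j 0 s := fun _ _ hω => by
    simp only [determined_levelWeight T w j 0 s hω]
  have hE0 : ∀ ω, (0 : ℝ) ≤ E.indicator 1 ω := Set.indicator_nonneg fun _ _ => zero_le_one
  have hE1 : ∀ ω, (E.indicator 1 ω : ℝ) ≤ 1 := fun ω =>
    Set.indicator_le_self' (fun _ _ => zero_le_one) ω
  have hf0 : ∀ ω, 0 ≤ f ω := fun ω => mul_nonneg (hE0 ω) (Real.exp_pos _).le
  have hfint : Integrable f μ := by
    refine Determined.integrable hT (n := m) (C := 1) ((hpast.indicator_one.mono hm).comp₂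
      (determined_levelWeight T w (j + 1) s m) fun y u => y * Real.exp (-(c * u))) fun ω => ?_
    rw [abs_of_nonneg (hf0 ω)]
    exact mul_le_one₀ (hE1 ω) (Real.exp_pos _).le (Real.exp_le_one_iff.2
      (neg_nonpos.2 (mul_nonneg hc ((T ω).levelWeight_nonneg hw _ _ _))))
  have hmoment : ∫ ω, f ω ∂μ ≤ Real.exp (-(q * (c * ∑ i ∈ Finset.Ioc s m, w i
      - c ^ 2 / 2 * ∑ i ∈ Finset.Ioc s m, w i ^ 2))) := by
    refine (integral_mul_exp_neg_levelWeight_le hT hw hw1 hK hs hpast.indicator_one hE0 hE1 hq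
      (fun ω hω => (Set.mem_of_indicator_ne_zero hω : ω ∈ E)) hc hm).trans
      (mul_le_of_le_one_right (Real.exp_pos _).le ?_)
    rw [integral_indicator_one (hpast.measurableSet hT)]
    exact measureReal_le_one
  have hsub : {ω | q * K ≤ (T ω).levelWeight w j 0 s ∧ (T ω).levelWeight w (j + 1) s m ≤ x} ⊆
      {ω | Real.exp (-(c * x)) ≤ f ω} := fun ω hω => by
    simp only [Set.mem_ofPred_eq, hf, Set.indicator_of_mem (show ω ∈ E from hω.1), Pi.one_apply,
      one_mul]
    exact Real.exp_le_exp.2 (neg_le_neg (mul_le_mul_of_nonneg_left hω.2 hc))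
  have hmarkov := mul_meas_ge_le_integral_of_nonneg (ae_of_all _ hf0) hfint (Real.exp (-(c * x)))
  rw [sub_eq_add_neg, Real.exp_add, ← div_le_iff₀' (Real.exp_pos _), div_eq_mul_inv,
    ← Real.exp_neg, mul_comm]
  exact (mul_le_mul_of_nonneg_left (measureReal_mono hsub) (Real.exp_pos _).le).trans
    (hmarkov.trans hmoment)

lemma measureReal_levelWeight_le_half_le (hT : IsWRT μ w T) (hw : ∀ n, 1 ≤ n → 0 ≤ w n)
    (hw1 : 0 < w 1) {K : ℝ} (hK : ∀ n, W w n ≤ K) {s j : ℕ} (hs : 1 ≤ s) {q : ℝ} (hq : 0 ≤ q)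
    {m : ℕ} (hm : s ≤ m) {M S : ℝ} (hM0 : 0 ≤ M) (hM : M ≤ ∑ i ∈ Finset.Ioc s m, w i)
    (hS0 : 0 < S) (hS : ∑ i ∈ Finset.Ioc s m, w i ^ 2 ≤ S) :
    μ.real {ω | q * K ≤ (T ω).levelWeight w j 0 s ∧
        (T ω).levelWeight w (j + 1) s m ≤ q * M / 2}
      ≤ Real.exp (-(q * M ^ 2 / (8 * S))) := by
  -- the minimizer of `c * (q * M / 2) - q * (c * M - c ^ 2 / 2 * S)`
  set c := M / (2 * S) with hc
  have hc0 : 0 ≤ c := by positivity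
  have hlinear := mul_le_mul_of_nonneg_left hM hc0
  have hquadratic := mul_le_mul_of_nonneg_left hS (show 0 ≤ c ^ 2 / 2 by positivity)
  refine (measureReal_levelWeight_le_le_exp hT hw hw1 hK hs hq hm hc0 _).trans
    (Real.exp_le_exp.2 ?_)
  calc c * (q * M / 2) - q * (c * ∑ i ∈ Finset.Ioc s m, w i
          - c ^ 2 / 2 * ∑ i ∈ Finset.Ioc s m, w i ^ 2)
      ≤ c * (q * M / 2) - q * (c * M - c ^ 2 / 2 * S) := by
        linarith [mul_le_mul_of_nonneg_left (sub_le_sub hlinear hquadratic) hq]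
    _ = -(q * M ^ 2 / (8 * S)) := by
        rw [hc]
        field_simp
        ring

theorem measure_not_forall_le_height_le (hT : IsWRT μ w T) (hw : ∀ n, 1 ≤ n → 0 ≤ w n)
    (hw1 : 0 < w 1) {K : ℝ} (hK0 : 0 < K) (hK : ∀ n, W w n ≤ K) {t : ℕ → ℕ} (ht : Monotone t)
    (ht0 : 1 ≤ t 0) {q M S : ℕ → ℝ} (hq : ∀ j, 0 < q j) (hq0 : q 0 * K ≤ W w (t 0))
    (hM0 : ∀ j, 0 ≤ M j) (hM : ∀ j, M j ≤ ∑ i ∈ Finset.Ioc (t j) (t (j + 1)), w i)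
    (hS0 : ∀ j, 0 < S j) (hS : ∀ j, ∑ i ∈ Finset.Ioc (t j) (t (j + 1)), w i ^ 2 ≤ S j)
    (hsucc : ∀ j, q (j + 1) * K ≤ q j * M j / 2) :
    μ {ω | ¬ ∀ j, j ≤ (T ω).height (t j)}
      ≤ ∑' j, ENNReal.ofReal (Real.exp (-(q j * M j ^ 2 / (8 * S j)))) := by
  have hsub : {ω | ¬ ∀ j, j ≤ (T ω).height (t j)} ⊆
      ⋃ j, {ω | q j * K ≤ (T ω).levelWeight w j 0 (t j) ∧
        (T ω).levelWeight w (j + 1) (t j) (t (j + 1)) ≤ q j * M j / 2} := by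
    intro ω hω
    by_contra hstep
    simp only [Set.mem_iUnion, Set.mem_ofPred_eq, not_exists, not_and, not_le] at hstep
    have hweight : ∀ j, q j * K ≤ (T ω).levelWeight w j 0 (t j) := by
      intro j
      induction j with
      | zero => rwa [GrowingTree.levelWeight_zero_zero]
      | succ j ih =>
        have hle := (T ω).levelWeight_le_levelWeight hw (j + 1) (Nat.zero_le (t j))
          (le_refl (t (j + 1)))
        linarith [hsucc j, hstep j ih]
    exact hω fun j =>
      (T ω).le_height_of_levelWeight_pos ((mul_pos (hq j) hK0).trans_le (hweight j))
  refine (measure_mono hsub).trans ((measure_iUnion_le _).trans (ENNReal.tsum_le_tsum fun j => ?_))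
  rw [← ofReal_measureReal]
  exact ENNReal.ofReal_le_ofReal (measureReal_levelWeight_le_half_le hT hw hw1 hK
    (ht0.trans (ht (Nat.zero_le j))) (hq j).le (ht (Nat.le_succ j)) (hM0 j) (hM j) (hS0 j) (hS j))

end ExponentialMoment

section SlowVariation

/-- The increments of `f` are `o(1)` uniformly over bounded steps and sublinear over long ones; for
`τ = 0` the bound `o(1)` over a step `u` improves to `o(u)`. This is what slow variation of `J`
gives for `f = log ∘ J ∘ exp`: `τ = 1` in general, `τ = 0` under the derivative condition. -/
def HasSlowIncrements (f : ℝ → ℝ) (τ : ℝ) : Prop :=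
  ∀ η > 0, ∀ᶠ y in atTop, ∀ u, 0 ≤ u → |f (y + u) - f y| ≤ η * (τ + u)

lemma tendsto_volume_setOf_le_abs_sub {f : ℝ → ℝ} (hf : Measurable f)
    (hlim : ∀ u, Tendsto (fun y => f (y + u) - f y) atTop (𝓝 0)) {η : ℝ} (hη : 0 < η) (b : ℝ) :
    Tendsto (fun y => volume (Set.Icc 0 b ∩ {u | η ≤ |f (y + u) - f y|})) atTop (𝓝 0) := by
  have hmeas : ∀ y, MeasurableSet (Set.Icc 0 b ∩ {u | η ≤ |f (y + u) - f y|}) := fun y =>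
    measurableSet_Icc.inter (measurableSet_le measurable_const
      ((hf.comp (measurable_const_add y)).sub measurable_const).abs)
  rw [← measure_empty (μ := (volume : Measure ℝ))]
  refine tendsto_measure_of_ae_tendsto_indicator atTop MeasurableSet.empty hmeas
    (measurableSet_Icc (a := (0 : ℝ)) (b := b)) (by simp)
    (Eventually.of_forall fun y => Set.inter_subset_left) (ae_of_all _ fun u => ?_)
  have habs := (hlim u).abs
  rw [abs_zero] at habs
  filter_upwards [habs.eventually_lt_const hη] with y hy
  simp [hy]

lemma exists_mem_Icc_notMem_sub_notMem {B B' : Set ℝ} {a b u : ℝ}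
    (h : volume B + volume B' < ENNReal.ofReal (b - a)) :
    ∃ v ∈ Set.Icc a b, v ∉ B ∧ v - u ∉ B' := by
  by_contra! hcover
  have hsub : Set.Icc a b ⊆ B ∪ (fun v => v - u) ⁻¹' B' := fun v hv =>
    or_iff_not_imp_left.2 (hcover v hv)
  have hshift : volume ((fun v => v - u) ⁻¹' B') = volume B' := by
    simpa only [sub_eq_add_neg] using measure_preimage_add_right volume (-u) B'
  have hle := (measure_mono hsub).trans (measure_union_le (μ := volume) _ _)
  rw [hshift, Real.volume_Icc] at hle
  exact hle.not_gt h

/-- The points `y` and `y + u` are compared through a common third point `y + v` outside the bad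
sets of both, which exists since these have small measure. -/
lemma eventually_forall_mem_Icc_abs_sub_le {f : ℝ → ℝ} (hf : Measurable f)
    (hlim : ∀ u, Tendsto (fun y => f (y + u) - f y) atTop (𝓝 0)) {η : ℝ} (hη : 0 < η) :
    ∀ᶠ y in atTop, ∀ u ∈ Set.Icc (0 : ℝ) 1, |f (y + u) - f y| ≤ η := by
  have hsmall := (tendsto_volume_setOf_le_abs_sub hf hlim (half_pos hη) 2).eventually_lt_const
    (show (0 : ENNReal) < ENNReal.ofReal (1 / 2) by simp)
  filter_upwards [eventually_forall_ge_atTop.2 hsmall] with y hy u hu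
  have hvolume := ENNReal.add_lt_add (hy y le_rfl) (hy (y + u) (by linarith [hu.1]))
  rw [← ENNReal.ofReal_add (by norm_num) (by norm_num)] at hvolume
  obtain ⟨v, hv, hvy, hvu⟩ := exists_mem_Icc_notMem_sub_notMem (u := u)
    (hvolume.trans_le (ENNReal.ofReal_le_ofReal (show 1 / 2 + 1 / 2 ≤ 2 - u by linarith [hu.2])))
  simp only [Set.mem_inter_iff, Set.mem_ofPred_eq, not_and, not_le] at hvy hvu
  have hleft := hvy ⟨hu.1.trans hv.1, hv.2⟩
  have hright := hvu ⟨by linarith [hv.1], by linarith [hv.2, hu.1]⟩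
  rw [show y + u + (v - u) = y + v by ring] at hright
  rw [abs_lt] at hleft hright
  exact abs_le.2 ⟨by linarith, by linarith⟩

lemma hasSlowIncrements_of_tendsto {f : ℝ → ℝ} (hf : Measurable f)
    (hlim : ∀ u, Tendsto (fun y => f (y + u) - f y) atTop (𝓝 0)) : HasSlowIncrements f 1 := by
  intro η hη
  obtain ⟨Y, hY⟩ := eventually_atTop.1 (eventually_forall_mem_Icc_abs_sub_le hf hlim hη)
  have hnat : ∀ n : ℕ, ∀ y ≥ Y, ∀ u ∈ Set.Icc (0 : ℝ) 1,
      |f (y + n + u) - f y| ≤ η * (1 + n) := by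
    intro n
    induction n with
    | zero => intro y hy u hu; simpa using hY y hy u hu
    | succ n ih =>
      intro y hy u hu
      have hrest := ih (y + 1) (by linarith) u hu
      have hfirst := hY y hy 1 (by simp)
      rw [show y + 1 + n + u = y + (n + 1 : ℕ) + u by push_cast; ring, abs_le] at hrest
      rw [abs_le] at hfirst ⊢
      push_cast at hrest ⊢
      constructor <;> linarith
  filter_upwards [eventually_ge_atTop Y] with y hy u hu
  have hfloor := hnat ⌊u⌋₊ y hy (u - ⌊u⌋₊)
    ⟨by linarith [Nat.floor_le hu], by linarith [Nat.lt_floor_add_one u]⟩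
  rw [show y + ⌊u⌋₊ + (u - ⌊u⌋₊) = y + u by ring] at hfloor
  exact hfloor.trans (mul_le_mul_of_nonneg_left (by linarith [Nat.floor_le hu]) hη.le)

lemma HasSlowIncrements.congr {f g : ℝ → ℝ} {τ : ℝ} (hf : HasSlowIncrements f τ)
    (hfg : f =ᶠ[atTop] g) : HasSlowIncrements g τ := by
  intro η hη
  filter_upwards [hf η hη, eventually_forall_ge_atTop.2 hfg] with y hy heq u hu
  rw [← heq y le_rfl, ← heq (y + u) (by linarith)]
  exact hy u hu

lemma HasSlowIncrements.eventually_abs_le_mul {f : ℝ → ℝ} {τ : ℝ} (hf : HasSlowIncrements f τ)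
    {η : ℝ} (hη : 0 < η) : ∀ᶠ y in atTop, |f y| ≤ η * y := by
  obtain ⟨Y, hY, hY0⟩ := ((hf (η / 2) (half_pos hη)).and (eventually_ge_atTop 0)).exists
  have hlinear : Tendsto (fun y => η / 2 * y) atTop atTop :=
    tendsto_id.const_mul_atTop (half_pos hη)
  filter_upwards [eventually_ge_atTop Y, hlinear.eventually_ge_atTop (|f Y| + η / 2 * τ)]
    with y hy hlarge
  have hincrement := hY (y - Y) (by linarith)
  rw [add_sub_cancel] at hincrement
  have htriangle : |f y| ≤ |f y - f Y| + |f Y| := by simpa using abs_add_le (f y - f Y) (f Y)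
  nlinarith [mul_nonneg hη.le hY0]

variable {J : ℝ → ℝ}

lemma SlowlyVarying.hasSlowIncrements_log_exp (hJpos : ∀ x, 1 ≤ x → 0 < J x)
    (hJ : SlowlyVarying J) : HasSlowIncrements (fun y => Real.log (J (Real.exp y))) 1 := by
  set f : ℝ → ℝ := fun y => Real.log (J (Real.exp (max y 0))) with hf
  have hmeas : Measurable f := by
    have hexp : Measurable fun y : ℝ =>
        (⟨Real.exp (max y 0), by simp [Set.mem_Ici]⟩ : Set.Ici (1 : ℝ)) :=
      Measurable.subtype_mk (by fun_prop)
    exact Real.measurable_log.comp (hJ.measurable.comp hexp)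
  have hlim : ∀ u, Tendsto (fun y => f (y + u) - f y) atTop (𝓝 0) := by
    intro u
    have hratio := (Real.continuousAt_log one_ne_zero).tendsto.comp
      ((hJ.tendsto (Real.exp u) (Real.exp_pos u)).comp Real.tendsto_exp_atTop)
    rw [Real.log_one] at hratio
    refine hratio.congr' ?_
    filter_upwards [eventually_ge_atTop 0, eventually_ge_atTop (-u)] with y hy hyu
    have hyu0 : 0 ≤ y + u := by linarith
    simp only [Function.comp, hf, max_eq_left hy, max_eq_left hyu0]
    rw [← Real.exp_add, add_comm u y, Real.log_div (hJpos _ (Real.one_le_exp hyu0)).ne'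
      (hJpos _ (Real.one_le_exp hy)).ne']
  refine (hasSlowIncrements_of_tendsto hmeas hlim).congr ?_
  filter_upwards [eventually_ge_atTop 0] with y hy
  simp only [hf, max_eq_left hy]

lemma SmoothlySlowlyVarying.hasSlowIncrements_log_exp (hJpos : ∀ x, 1 ≤ x → 0 < J x)
    (hJ : SmoothlySlowlyVarying 1 J) :
    HasSlowIncrements (fun y => Real.log (J (Real.exp y))) 0 := by
  intro η hη
  have hdiff : DifferentiableOn ℝ J (Set.Ici 1) := by
    simpa using hJ.differentiableOn 0 zero_lt_one
  have hlim := ((hJ.tendsto 1 le_rfl le_rfl).comp Real.tendsto_exp_atTop).abs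
  simp only [Function.comp_def, pow_one, iteratedDerivWithin_one, abs_zero] at hlim
  obtain ⟨Y, hY⟩ := eventually_atTop.1
    ((hlim.eventually_lt_const hη).and (eventually_gt_atTop (0 : ℝ)))
  have hderiv : ∀ y ∈ Set.Ici Y, HasDerivWithinAt (fun y => Real.log (J (Real.exp y)))
      (Real.exp y * derivWithin J (Set.Ici 1) (Real.exp y) / J (Real.exp y)) (Set.Ici Y) y := by
    intro y hy
    have hexp : 1 < Real.exp y := Real.one_lt_exp_iff.2 (hY y hy).2
    have hJderiv : HasDerivAt J (derivWithin J (Set.Ici 1) (Real.exp y)) (Real.exp y) :=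
      (hdiff _ hexp.le).hasDerivWithinAt.hasDerivAt (Ici_mem_nhds hexp)
    rw [mul_comm (Real.exp y)]
    exact ((hJderiv.comp y (Real.hasDerivAt_exp y)).log (hJpos _ hexp.le).ne').hasDerivWithinAt
  filter_upwards [eventually_ge_atTop Y] with y hy u hu
  simpa [abs_of_nonneg hu] using (convex_Ici Y).norm_image_sub_le_of_norm_hasDerivWithin_le
    (C := η) hderiv (fun x hx => (hY x hx).1.le) (x := y) (y := y + u) hy
    (Set.mem_Ici.2 (by linarith [show Y ≤ y from hy]))

end SlowVariation

section PowerIncrement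

lemma rpow_min_zero_le_one {x : ℝ} (hx : 1 ≤ x) (e : ℝ) : x ^ min e 0 ≤ 1 :=
  Real.rpow_le_one_of_one_le_of_nonpos hx (min_le_right _ _)

lemma one_add_mul_div_le_one_add_rpow {h β : ℝ} (hh : 0 ≤ h) (hβ : 0 ≤ β) :
    1 + β * (h / (1 + h)) ≤ (1 + h) ^ β := by
  have hlog : h / (1 + h) ≤ Real.log (1 + h) := by
    convert Real.one_sub_inv_le_log_of_pos (show 0 < 1 + h by positivity) using 1
    field_simp
    ring
  rw [Real.rpow_def_of_pos (by positivity)]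
  nlinarith [Real.add_one_le_exp (Real.log (1 + h) * β)]

lemma mul_rpow_min_le_rpow_mul_div {β c x : ℝ} (hβ : 0 < β) (hc : 0 < c) (hx : 1 ≤ x) :
    c / (1 + c) * x ^ min (2 * β - 1) 0
      ≤ x ^ β * (c * x ^ (β - 1) / (1 + c * x ^ (β - 1))) := by
  have hx0 : 0 < x := by linarith
  rcases le_or_gt β 1 with hβ1 | hβ1
  · have hpow : x ^ (β - 1) ≤ 1 := Real.rpow_le_one_of_one_le_of_nonpos hx (by linarith)
    calc c / (1 + c) * x ^ min (2 * β - 1) 0 ≤ c / (1 + c) * x ^ (2 * β - 1) :=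
          mul_le_mul_of_nonneg_left
            (Real.rpow_le_rpow_of_exponent_le hx (min_le_left _ _)) (by positivity)
      _ = x ^ β * (c * x ^ (β - 1) / (1 + c)) := by
          rw [show 2 * β - 1 = β + (β - 1) by ring, Real.rpow_add hx0]; ring
      _ ≤ _ := by
          gcongr
          exact mul_le_of_le_one_right hc.le hpow
  · have hpow : 1 ≤ x ^ (β - 1) := Real.one_le_rpow hx (by linarith)
    rw [mul_comm]
    refine mul_le_mul (Real.rpow_le_rpow_of_exponent_le hx ((min_le_right _ _).trans hβ.le)) ?_
      (by positivity) (by positivity)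
    rw [div_le_div_iff₀ (by positivity) (by positivity)]
    nlinarith

lemma rpow_add_mul_le_rpow_of_add_mul_rpow_le {β c x z : ℝ} (hβ : 0 < β) (hc : 0 < c)
    (hx : 1 ≤ x) (hz : x + c * x ^ β ≤ z) :
    x ^ β + β * (c / (1 + c)) * x ^ min (2 * β - 1) 0 ≤ z ^ β := by
  have hx0 : 0 < x := by linarith
  set h := c * x ^ (β - 1) with hh
  have hfactor : x + c * x ^ β = x * (1 + h) := by
    rw [hh, mul_add, mul_one, mul_left_comm, ← Real.rpow_one_add' hx0.le (by linarith)]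
    ring_nf
  calc x ^ β + β * (c / (1 + c)) * x ^ min (2 * β - 1) 0
      ≤ x ^ β + β * (x ^ β * (h / (1 + h))) := by
        rw [mul_assoc]
        linarith [mul_le_mul_of_nonneg_left (mul_rpow_min_le_rpow_mul_div hβ hc hx) hβ.le]
    _ = x ^ β * (1 + β * (h / (1 + h))) := by ring
    _ ≤ x ^ β * (1 + h) ^ β := by
        gcongr
        exact one_add_mul_div_le_one_add_rpow (by positivity) hβ.le
    _ = (x + c * x ^ β) ^ β := by rw [hfactor, Real.mul_rpow hx0.le (by positivity)]
    _ ≤ z ^ β := Real.rpow_le_rpow (by positivity) hz hβ.le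

end PowerIncrement

lemma tendsto_log_natCast : Tendsto (fun n : ℕ => Real.log n) atTop atTop :=
  Real.tendsto_log_atTop.comp tendsto_natCast_atTop_atTop

/-- The sequence `A` decays like `exp (-γ (log n) ^ β)` on the scale of exponents, and a window
`(n, m]` of logarithmic length of order `(log n) ^ β` carries at least the fraction `1 / log n` of
its value. These are the only properties of `A n = a_∞ - a n` on which the height depends. -/
structure StretchedExpDecay (A : ℕ → ℝ) (γ β : ℝ) : Prop where
  lower : ∀ c, γ < c → ∀ᶠ n : ℕ in atTop, Real.exp (-(c * Real.log n ^ β)) ≤ A n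
  upper : ∀ c, c < γ → ∀ᶠ n : ℕ in atTop, A n ≤ Real.exp (-(c * Real.log n ^ β))
  window : ∀ c, 0 < c → ∀ᶠ n : ℕ in atTop, ∀ m : ℕ,
    Real.log n + c * Real.log n ^ β ≤ Real.log m → A n / Real.log n ≤ A n - A m

section StretchedExpDecay

lemma exp_neg_two_mul_le_one_sub {y : ℝ} (hy0 : 0 ≤ y) (hy : y ≤ 1 / 2) :
    Real.exp (-(2 * y)) ≤ 1 - y := by
  rw [Real.exp_neg, inv_le_comm₀ (Real.exp_pos _) (by linarith)]
  refine le_trans ?_ (Real.add_one_le_exp (2 * y))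
  rw [inv_le_iff_one_le_mul₀ (by linarith)]
  nlinarith

lemma eventually_exp_neg_le_one_add_and_le_exp {r : ℕ → ℝ} {e : ℝ}
    (hr : r =o[atTop] fun n : ℕ => Real.log n ^ min e 0) {η : ℝ} (hη : 0 < η) :
    ∀ᶠ n : ℕ in atTop, Real.exp (-(η * Real.log n ^ min e 0)) ≤ 1 + r n ∧
      1 + r n ≤ Real.exp (η * Real.log n ^ min e 0) := by
  have hδ : 0 < min (η / 2) (1 / 2) := by positivity
  filter_upwards [hr.bound hδ, tendsto_log_natCast.eventually_ge_atTop 1] with n hn hlog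
  set θ := Real.log n ^ min e 0
  have hθ0 : 0 ≤ θ := Real.rpow_nonneg (by linarith) _
  have hθ1 : θ ≤ 1 := rpow_min_zero_le_one hlog e
  rw [Real.norm_of_nonneg hθ0, Real.norm_eq_abs, abs_le] at hn
  set y := min (η / 2) (1 / 2) * θ
  have hy0 : 0 ≤ y := by positivity
  have hyhalf : y ≤ 1 / 2 := (mul_le_of_le_one_right hδ.le hθ1).trans (min_le_right _ _)
  have hyη : 2 * y ≤ η * θ := by
    have := mul_le_mul_of_nonneg_right (min_le_left (η / 2) (1 / 2)) hθ0
    linarith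
  constructor
  · calc Real.exp (-(η * θ)) ≤ Real.exp (-(2 * y)) := Real.exp_le_exp.2 (neg_le_neg hyη)
      _ ≤ 1 - y := exp_neg_two_mul_le_one_sub hy0 hyhalf
      _ ≤ 1 + r n := by linarith
  · linarith [Real.add_one_le_exp (η * θ)]

lemma eventually_inv_le_one_sub_exp_neg_mul_rpow {d e : ℝ} (hd : 0 < d) (he : -1 < e)
    (he0 : e ≤ 0) : ∀ᶠ x : ℝ in atTop, x⁻¹ ≤ 1 - Real.exp (-(d * x ^ e)) := by
  filter_upwards [(tendsto_rpow_atTop (show 0 < 1 + e by linarith)).eventually_ge_atTop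
    ((1 + d) / d), eventually_ge_atTop 1] with x hlarge hx
  have hx0 : 0 < x := by linarith
  have hpow1 : x ^ e ≤ 1 := Real.rpow_le_one_of_one_le_of_nonpos hx he0
  rw [Real.rpow_add hx0, Real.rpow_one, div_le_iff₀ hd] at hlarge
  calc x⁻¹ ≤ d * x ^ e / (1 + d) := by
        rw [inv_eq_one_div, div_le_div_iff₀ hx0 (by positivity)]; linarith
    _ ≤ d * x ^ e / (1 + d * x ^ e) := by
        gcongr
        exact mul_le_of_le_one_right hd.le hpow1
    _ = 1 - (1 + d * x ^ e)⁻¹ := by field_simp; ring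
    _ ≤ 1 - Real.exp (-(d * x ^ e)) := by
        rw [Real.exp_neg]
        gcongr
        linarith [Real.add_one_le_exp (d * x ^ e)]

variable {A r : ℕ → ℝ} {f : ℝ → ℝ} {γ β τ : ℝ}

lemma eventually_exp_le_and_le_exp (hβ : 0 < β) (hf : HasSlowIncrements f τ)
    (hr : r =o[atTop] fun n : ℕ => Real.log n ^ min (2 * β - 1) 0)
    (hA : ∀ᶠ n : ℕ in atTop,
      A n = Real.exp (-(γ * Real.log n ^ β) + f (Real.log n ^ β)) * (1 + r n))
    {η : ℝ} (hη : 0 < η) :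
    ∀ᶠ n : ℕ in atTop, Real.exp (-((γ + η) * Real.log n ^ β)) ≤ A n ∧
      A n ≤ Real.exp (-((γ - η) * Real.log n ^ β)) := by
  have hpow : Tendsto (fun n : ℕ => Real.log n ^ β) atTop atTop :=
    (tendsto_rpow_atTop hβ).comp tendsto_log_natCast
  filter_upwards [hA, hpow.eventually (hf.eventually_abs_le_mul (half_pos hη)),
    eventually_exp_neg_le_one_add_and_le_exp hr one_pos,
    tendsto_log_natCast.eventually_ge_atTop 1,
    (hpow.const_mul_atTop (half_pos hη)).eventually_ge_atTop 1] with n hAn hfn hrn hlog hlarge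
  have hθ := rpow_min_zero_le_one hlog (2 * β - 1)
  rw [abs_le] at hfn
  rw [hAn]
  constructor
  · refine le_trans ?_ (mul_le_mul_of_nonneg_left hrn.1 (Real.exp_pos _).le)
    rw [← Real.exp_add]
    exact Real.exp_le_exp.2 (by linarith)
  · refine (mul_le_mul_of_nonneg_left hrn.2 (Real.exp_pos _).le).trans ?_
    rw [← Real.exp_add]
    exact Real.exp_le_exp.2 (by linarith)

lemma le_of_log_natCast_le_log_natCast {n m : ℕ} (hn : 0 < Real.log n)
    (h : Real.log n ≤ Real.log m) : n ≤ m := by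
  have hm : 0 < m := Nat.pos_of_ne_zero fun hm => by simp [hm] at h; linarith
  have hn0 : 0 < n := Nat.pos_of_ne_zero fun hn0 => by simp [hn0] at hn
  exact_mod_cast (Real.log_le_log_iff (by exact_mod_cast hn0) (by exact_mod_cast hm)).1 h

lemma exists_eventually_le_exp_mul (hγ : 0 < γ) (hβ : 0 < β) (hf : HasSlowIncrements f τ)
    (hτ : ∀ x : ℝ, 1 ≤ x → τ ≤ x ^ min (2 * β - 1) 0)
    (hr : r =o[atTop] fun n : ℕ => Real.log n ^ min (2 * β - 1) 0)
    (hA : ∀ᶠ n : ℕ in atTop,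
      A n = Real.exp (-(γ * Real.log n ^ β) + f (Real.log n ^ β)) * (1 + r n))
    {c : ℝ} (hc : 0 < c) :
    ∃ d > 0, ∀ᶠ n : ℕ in atTop, ∀ m : ℕ, Real.log n + c * Real.log n ^ β ≤ Real.log m →
      A m ≤ Real.exp (-(d * Real.log n ^ min (2 * β - 1) 0)) * A n := by
  set k := β * (c / (1 + c))
  have hk0 : 0 < k := by positivity
  -- `η` solves `(γ - η) * k - 3 * η = γ * k / 2`
  set η := γ * k / (2 * (k + 3))
  have hη0 : 0 < η := by positivity
  have hηk : η * (2 * (k + 3)) = γ * k := div_mul_cancel₀ _ (by positivity)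
  have hηγ : η ≤ γ := by nlinarith
  have hpow : Tendsto (fun n : ℕ => Real.log n ^ β) atTop atTop :=
    (tendsto_rpow_atTop hβ).comp tendsto_log_natCast
  refine ⟨γ * k / 2, by positivity, ?_⟩
  filter_upwards [hpow.eventually (hf η hη0), eventually_forall_ge_atTop.2
    (hA.and (eventually_exp_neg_le_one_add_and_le_exp hr hη0)),
    tendsto_log_natCast.eventually_ge_atTop 1] with n hfn hAr hx m hm
  set x := Real.log n with hxn
  set z := Real.log m with hzm
  have hxz : x ≤ z := le_trans (le_add_of_nonneg_right (by positivity)) hm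
  obtain ⟨hAn, hrn, -⟩ := hAr n le_rfl
  obtain ⟨hAm, -, hrm⟩ := hAr m (le_of_log_natCast_le_log_natCast (by linarith) hxz)
  have hpower := rpow_add_mul_le_rpow_of_add_mul_rpow_le hβ hc hx hm
  have hθ0 : 0 ≤ x ^ min (2 * β - 1) 0 := by positivity
  have hθz : z ^ min (2 * β - 1) 0 ≤ x ^ min (2 * β - 1) 0 :=
    Real.rpow_le_rpow_of_nonpos (by linarith) hxz (min_le_right _ _)
  have hτx := hτ x hx
  set θ := x ^ min (2 * β - 1) 0
  have hincrement := (abs_le.1 (hfn (z ^ β - x ^ β) (by nlinarith))).2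
  rw [add_sub_cancel] at hincrement
  rw [hAm, hAn, ← hxn, ← hzm]
  calc Real.exp (-(γ * z ^ β) + f (z ^ β)) * (1 + r m)
      ≤ Real.exp (-(γ * z ^ β) + f (z ^ β)) * Real.exp (η * θ) := by
        gcongr
        exact hrm.trans (Real.exp_le_exp.2 (mul_le_mul_of_nonneg_left hθz hη0.le))
    _ ≤ Real.exp (-(γ * k / 2 * θ)) *
          (Real.exp (-(γ * x ^ β) + f (x ^ β)) * Real.exp (-(η * θ))) := by
        rw [← Real.exp_add, ← Real.exp_add, ← Real.exp_add]
        refine Real.exp_le_exp.2 ?_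
        nlinarith [mul_le_mul_of_nonneg_left hpower (sub_nonneg.2 hηγ),
          mul_le_mul_of_nonneg_left hτx hη0.le]
    _ ≤ _ := by gcongr

theorem stretchedExpDecay_of_eq_exp_mul (hγ : 0 < γ) (hβ : 0 < β) (hf : HasSlowIncrements f τ)
    (hτ : ∀ x : ℝ, 1 ≤ x → τ ≤ x ^ min (2 * β - 1) 0)
    (hr : r =o[atTop] fun n : ℕ => Real.log n ^ min (2 * β - 1) 0)
    (hA : ∀ᶠ n : ℕ in atTop,
      A n = Real.exp (-(γ * Real.log n ^ β) + f (Real.log n ^ β)) * (1 + r n)) :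
    StretchedExpDecay A γ β where
  lower c hc := by
    filter_upwards [eventually_exp_le_and_le_exp hβ hf hr hA (sub_pos.2 hc)] with n hn
    simpa using hn.1
  upper c hc := by
    filter_upwards [eventually_exp_le_and_le_exp hβ hf hr hA (sub_pos.2 hc)] with n hn
    simpa using hn.2
  window c hc := by
    obtain ⟨d, hd, hratio⟩ := exists_eventually_le_exp_mul hγ hβ hf hτ hr hA hc
    have hgap := tendsto_log_natCast.eventually (eventually_inv_le_one_sub_exp_neg_mul_rpow hd
      (lt_min (show -1 < 2 * β - 1 by linarith) (by norm_num)) (min_le_right _ _))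
    filter_upwards [hratio, hgap, eventually_exp_le_and_le_exp hβ hf hr hA one_pos]
      with n hn hgapn hAn m hm
    have hA0 : 0 ≤ A n := (Real.exp_pos _).le.trans hAn.1
    calc A n / Real.log n = (Real.log n)⁻¹ * A n := by rw [mul_comm, div_eq_mul_inv]
      _ ≤ (1 - Real.exp (-(d * Real.log n ^ min (2 * β - 1) 0))) * A n :=
          mul_le_mul_of_nonneg_right hgapn hA0
      _ ≤ A n - A m := by linarith [hn m hm]

theorem stretchedExpDecay_of_eq_mainTerm_mul {α : ℝ} {J : ℝ → ℝ} (hα : 1 < α) (hβ : 0 < β)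
    (hJpos : ∀ x, 1 ≤ x → 0 < J x) (hJ1 : β < 1 / 2 → SmoothlySlowlyVarying 1 J)
    (hJ0 : 1 / 2 ≤ β → SlowlyVarying J)
    (hr : r =o[atTop] fun n : ℕ => Real.log n ^ min (2 * β - 1) 0)
    (hA : ∀ᶠ n : ℕ in atTop, A n = mainTerm α β J n * (1 + r n)) :
    StretchedExpDecay A (α - 1) β := by
  have hA' : ∀ᶠ n : ℕ in atTop, A n = Real.exp (-((α - 1) * Real.log n ^ β)
      + Real.log (J (Real.exp (Real.log n ^ β)))) * (1 + r n) := by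
    filter_upwards [hA, tendsto_log_natCast.eventually_ge_atTop 0] with n hn hlog
    rw [hn, mainTerm, Real.exp_add, neg_mul,
      Real.exp_log (hJpos _ (Real.one_le_exp (Real.rpow_nonneg hlog _)))]
  rcases lt_or_ge β (1 / 2) with hβ2 | hβ2
  · exact stretchedExpDecay_of_eq_exp_mul (sub_pos.2 hα) hβ
      ((hJ1 hβ2).hasSlowIncrements_log_exp hJpos)
      (fun x hx => Real.rpow_nonneg (by linarith) _) hr hA'
  · refine stretchedExpDecay_of_eq_exp_mul (sub_pos.2 hα) hβ
      ((hJ0 hβ2).hasSlowIncrements_log_exp hJpos) (fun x _ => ?_) hr hA'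
    rw [min_eq_right (by linarith), Real.rpow_zero]

end StretchedExpDecay

section Rounding

lemma isEquivalent_log_of_isEquivalent_exp {g : ℝ → ℝ} (hg : g ~[atTop] Real.exp) :
    (fun x => Real.log (g x)) ~[atTop] id := by
  have hratio := (isEquivalent_iff_tendsto_one
    (Eventually.of_forall fun x => (Real.exp_pos x).ne')).1 hg
  have hlog := (Real.continuousAt_log one_ne_zero).tendsto.comp hratio
  rw [Real.log_one] at hlog
  refine (((isLittleO_one_iff ℝ).2 hlog).trans (isLittleO_const_id_atTop 1)).congr' ?_ .rfl
  filter_upwards [hratio.eventually_ne one_ne_zero] with x hx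
  have hgx : g x ≠ 0 := fun h => hx (by simp [h])
  simp [Real.log_div hgx (Real.exp_pos x).ne']

lemma isEquivalent_log_floor_exp : (fun x => Real.log ⌊Real.exp x⌋₊) ~[atTop] id :=
  isEquivalent_log_of_isEquivalent_exp
    (isEquivalent_nat_floor.comp_tendsto Real.tendsto_exp_atTop)

lemma isEquivalent_log_ceil_exp : (fun x => Real.log ⌈Real.exp x⌉₊) ~[atTop] id :=
  isEquivalent_log_of_isEquivalent_exp
    (isEquivalent_nat_ceil.comp_tendsto Real.tendsto_exp_atTop)

lemma tendsto_ceil_exp : Tendsto (fun x : ℝ => ⌈Real.exp x⌉₊) atTop atTop :=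
  tendsto_nat_ceil_atTop.comp Real.tendsto_exp_atTop

lemma le_log_ceil_exp (x : ℝ) : x ≤ Real.log ⌈Real.exp x⌉₊ :=
  (Real.le_log_iff_exp_le ((Real.exp_pos x).trans_le (Nat.le_ceil _))).2 (Nat.le_ceil _)

lemma log_ceil_exp_le {x : ℝ} (hx : 0 ≤ x) : Real.log ⌈Real.exp x⌉₊ ≤ x + 1 := by
  rw [Real.log_le_iff_le_exp ((Real.exp_pos x).trans_le (Nat.le_ceil _)), Real.exp_add]
  nlinarith [Nat.ceil_lt_add_one (Real.exp_pos x).le, Real.one_le_exp hx,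
    Real.add_one_le_exp (1 : ℝ)]

lemma eventually_mul_rpow_le_mul_rpow {ι : Type*} {l : Filter ι} {u v : ι → ℝ} (huv : u ~[l] v)
    (hu : ∀ᶠ x in l, 0 ≤ u x) (hv : ∀ᶠ x in l, 0 < v x) {c d : ℝ} (hcd : c < d) (b : ℝ) :
    ∀ᶠ x in l, c * u x ^ b ≤ d * v x ^ b := by
  have hratio := (((isEquivalent_iff_tendsto_one (hv.mono fun x hx => hx.ne')).1 huv).rpow_const
    (p := b) (Or.inl one_ne_zero)).const_mul c
  rw [Real.one_rpow, mul_one] at hratio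
  filter_upwards [hratio.eventually_lt_const hcd, hu, hv] with x hx hux hvx
  rw [Pi.div_apply, Real.div_rpow hux hvx.le, mul_div_assoc',
    div_lt_iff₀ (Real.rpow_pos_of_pos hvx b)] at hx
  exact hx.le

end Rounding

section Growth

lemma tendsto_mul_rpow_atTop {c κ β : ℝ} (hc : 0 < c) (hκ : 0 < κ) (hβ : 0 < β) :
    Tendsto (fun L : ℝ => c * (κ * L) ^ β) atTop atTop :=
  ((tendsto_rpow_atTop hβ).comp (tendsto_id.const_mul_atTop hκ)).const_mul_atTop hc

lemma eventually_mul_le_exp_mul_rpow {d β : ℝ} (hd : 0 < d) (hβ : 0 < β) (C : ℝ) :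
    ∀ᶠ x : ℝ in atTop, C * x ≤ Real.exp (d * x ^ β) := by
  have hbound := (tendsto_rpow_atTop hβ).eventually
    (((isLittleO_rpow_exp_pos_mul_atTop (1 / β) hd).const_mul_left C).bound one_pos)
  filter_upwards [hbound, eventually_ge_atTop 0] with x hx hx0
  rw [← Real.rpow_mul hx0, mul_one_div_cancel hβ.ne', Real.rpow_one, one_mul,
    Real.norm_of_nonneg (Real.exp_pos _).le] at hx
  exact (Real.le_norm_self _).trans hx

lemma eventually_mul_sq_log_ceil_exp_le {κ s : ℝ} (hκ : 0 < κ) (hs : κ⁻¹ < s) (C : ℝ) :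
    ∀ᶠ L : ℝ in atTop, C * L * Real.log ⌈Real.exp (κ * L)⌉₊ ^ 2
      ≤ Real.exp (-L) * (⌈Real.exp (κ * L)⌉₊ : ℝ) ^ s := by
  have hs0 : 0 < s := (inv_pos.2 hκ).trans hs
  have hrate : 0 < κ * s - 1 := sub_pos.2 ((inv_lt_iff_one_lt_mul₀' hκ).1 hs)
  filter_upwards [((isLittleO_pow_exp_pos_mul_atTop 3 hrate).const_mul_left
    (|C| * (κ + 1) ^ 2)).bound one_pos, eventually_ge_atTop 1] with L hcubic hL
  have hlog0 : 0 ≤ Real.log ⌈Real.exp (κ * L)⌉₊ := Real.log_natCast_nonneg _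
  have hlog : Real.log ⌈Real.exp (κ * L)⌉₊ ≤ (κ + 1) * L := by
    linarith [log_ceil_exp_le (show 0 ≤ κ * L by positivity)]
  rw [one_mul, Real.norm_of_nonneg (Real.exp_pos _).le] at hcubic
  calc C * L * Real.log ⌈Real.exp (κ * L)⌉₊ ^ 2 ≤ |C| * L * ((κ + 1) * L) ^ 2 := by
        gcongr
        exact le_abs_self C
    _ = |C| * (κ + 1) ^ 2 * L ^ 3 := by ring
    _ ≤ Real.exp ((κ * s - 1) * L) := (Real.le_norm_self _).trans hcubic
    _ = Real.exp (-L) * Real.exp (κ * L) ^ s := by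
        rw [← Real.exp_mul, ← Real.exp_add]; ring_nf
    _ ≤ Real.exp (-L) * (⌈Real.exp (κ * L)⌉₊ : ℝ) ^ s := by
        gcongr
        exact Nat.le_ceil _

end Growth

namespace StretchedExpDecay

variable {A : ℕ → ℝ} {γ β c : ℝ}

lemma eventually_floor_exp_le (hA : StretchedExpDecay A γ β) (hc : c < γ) :
    ∀ᶠ x : ℝ in atTop, A ⌊Real.exp x⌋₊ ≤ Real.exp (-(c * x ^ β)) := by
  obtain ⟨c', hcc', hc'⟩ := exists_between hc
  have hlog := isEquivalent_log_floor_exp.symm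
  filter_upwards [(tendsto_nat_floor_atTop.comp Real.tendsto_exp_atTop).eventually
    (hA.upper c' hc'), eventually_mul_rpow_le_mul_rpow hlog (eventually_ge_atTop 0)
      ((hlog.tendsto_atTop tendsto_id).eventually_gt_atTop 0) hcc' β] with x hx hpow
  exact hx.trans (Real.exp_le_exp.2 (neg_le_neg hpow))

lemma eventually_le_ceil_exp (hA : StretchedExpDecay A γ β) (hc : γ < c) :
    ∀ᶠ x : ℝ in atTop, Real.exp (-(c * x ^ β)) ≤ A ⌈Real.exp x⌉₊ := by
  obtain ⟨c', hc', hcc'⟩ := exists_between hc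
  filter_upwards [tendsto_ceil_exp.eventually (hA.lower c' hc'),
    eventually_mul_rpow_le_mul_rpow isEquivalent_log_ceil_exp
      (Eventually.of_forall fun x => Real.log_natCast_nonneg _) (eventually_gt_atTop 0) hcc' β]
    with x hx hpow
  exact (Real.exp_le_exp.2 (neg_le_neg hpow)).trans hx

lemma eventually_const_mul_exp_le_ceil_exp_div_log (hA : StretchedExpDecay A γ β) (hβ : 0 < β)
    (hc : γ < c) {C : ℝ} (hC : 0 ≤ C) :
    ∀ᶠ x : ℝ in atTop,
      C * Real.exp (-(c * x ^ β)) ≤ A ⌈Real.exp x⌉₊ / Real.log ⌈Real.exp x⌉₊ := by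
  obtain ⟨c', hc', hcc'⟩ := exists_between hc
  filter_upwards [hA.eventually_le_ceil_exp hc',
    eventually_mul_le_exp_mul_rpow (sub_pos.2 hcc') hβ (C * 2), eventually_ge_atTop 1]
    with x hx hexp hx1
  have hlog0 : 0 < Real.log ⌈Real.exp x⌉₊ := by linarith [le_log_ceil_exp x]
  have hlog : Real.log ⌈Real.exp x⌉₊ ≤ 2 * x := by linarith [log_ceil_exp_le (x := x) (by linarith)]
  rw [le_div_iff₀ hlog0]
  calc C * Real.exp (-(c * x ^ β)) * Real.log ⌈Real.exp x⌉₊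
      ≤ C * Real.exp (-(c * x ^ β)) * (2 * x) := by gcongr
    _ = C * 2 * x * Real.exp (-(c * x ^ β)) := by ring
    _ ≤ Real.exp ((c - c') * x ^ β) * Real.exp (-(c * x ^ β)) := by gcongr
    _ = Real.exp (-(c' * x ^ β)) := by rw [← Real.exp_add]; ring_nf
    _ ≤ A ⌈Real.exp x⌉₊ := hx

lemma eventually_ceil_exp_div_log_le_sub (hA : StretchedExpDecay A γ β) (hβ : 0 < β)
    (hc : 0 < c) :
    ∀ᶠ x : ℝ in atTop, ∀ z : ℝ, x + c * x ^ β ≤ z →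
      A ⌈Real.exp x⌉₊ / Real.log ⌈Real.exp x⌉₊ ≤ A ⌈Real.exp x⌉₊ - A ⌈Real.exp z⌉₊ := by
  have hpow : Tendsto (fun x : ℝ => c / 4 * x ^ β) atTop atTop :=
    (tendsto_rpow_atTop hβ).const_mul_atTop (by positivity)
  filter_upwards [tendsto_ceil_exp.eventually (hA.window (c / 2) (by positivity)),
    eventually_mul_rpow_le_mul_rpow isEquivalent_log_ceil_exp
      (Eventually.of_forall fun x => Real.log_natCast_nonneg _) (eventually_gt_atTop 0)
      (show c / 2 < c * (3 / 4) by linarith) β,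
    hpow.eventually_ge_atTop 1, eventually_ge_atTop 0] with x hwindow hcompare hlarge hx z hz
  refine hwindow _ ?_
  rw [id_eq] at hcompare
  linarith [log_ceil_exp_le hx, le_log_ceil_exp z]

end StretchedExpDecay

section Orbit

/-- The orbit of `l` under `L ↦ L + g L`; it is the sequence of logarithmic times at which the
height increases by one. -/
noncomputable def orbit (g : ℝ → ℝ) (l : ℝ) : ℕ → ℝ
  | 0 => l
  | i + 1 => orbit g l i + g (orbit g l i)

variable {g Ψ : ℝ → ℝ} {l x x₀ d : ℝ}

lemma add_le_orbit (hg : ∀ L, l ≤ L → 1 ≤ g L) (i : ℕ) : l + i ≤ orbit g l i := by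
  induction i with
  | zero => simp [orbit]
  | succ i ih =>
    have hstep := hg (orbit g l i) (le_trans (le_add_of_nonneg_right i.cast_nonneg) ih)
    rw [orbit]
    push_cast
    linarith

lemma le_orbit (hg : ∀ L, l ≤ L → 1 ≤ g L) (i : ℕ) : l ≤ orbit g l i :=
  (le_add_of_nonneg_right i.cast_nonneg).trans (add_le_orbit hg i)

lemma orbit_mono (hg : ∀ L, l ≤ L → 1 ≤ g L) : Monotone (orbit g l) :=
  monotone_nat_of_le_succ fun i => by
    rw [orbit]
    linarith [hg _ (le_orbit hg i)]

lemma mul_le_apply_orbit (hg : ∀ L, l ≤ L → 1 ≤ g L) (hl : 0 ≤ Ψ l)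
    (hΨ : ∀ L, l ≤ L → Ψ L + d ≤ Ψ (L + g L)) (i : ℕ) : i * d ≤ Ψ (orbit g l i) := by
  induction i with
  | zero => simpa [orbit] using hl
  | succ i ih =>
    rw [orbit]
    push_cast
    linarith [hΨ _ (le_orbit hg i)]

lemma apply_orbit_le (hg : ∀ L, l ≤ L → 1 ≤ g L)
    (hΨ : ∀ L, l ≤ L → Ψ (L + g L) ≤ Ψ L + d) (i : ℕ) : Ψ (orbit g l i) ≤ Ψ l + i * d := by
  induction i with
  | zero => simp [orbit]
  | succ i ih =>
    rw [orbit]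
    push_cast
    linarith [hΨ _ (le_orbit hg i)]

lemma le_orbit_ceil_div (hmono : StrictMonoOn Ψ (Set.Ici x₀)) (hl : x₀ ≤ l) (hx : x₀ ≤ x)
    (hd : 0 < d) (hg : ∀ L, l ≤ L → 1 ≤ g L) (hΨl : 0 ≤ Ψ l)
    (hΨ : ∀ L, l ≤ L → Ψ L + d ≤ Ψ (L + g L)) : x ≤ orbit g l ⌈Ψ x / d⌉₊ := by
  rw [← hmono.le_iff_le hx (hl.trans (le_orbit hg _))]
  refine le_trans ?_ (mul_le_apply_orbit hg hΨl hΨ _)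
  rw [← div_le_iff₀ hd]
  exact Nat.le_ceil _

lemma orbit_floor_div_le (hmono : StrictMonoOn Ψ (Set.Ici x₀)) (hl : x₀ ≤ l) (hx : x₀ ≤ x)
    (hd : 0 < d) (hg : ∀ L, l ≤ L → 1 ≤ g L) (hΨx : Ψ l ≤ Ψ x)
    (hΨ : ∀ L, l ≤ L → Ψ (L + g L) ≤ Ψ L + d) : orbit g l ⌊(Ψ x - Ψ l) / d⌋₊ ≤ x := by
  rw [← hmono.le_iff_le (hl.trans (le_orbit hg _)) hx]
  refine (apply_orbit_le hg hΨ _).trans ?_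
  rw [← le_sub_iff_add_le', ← le_div_iff₀ hd]
  exact Nat.floor_le (div_nonneg (sub_nonneg.2 hΨx) hd.le)

lemma tsum_ofReal_exp_neg_mul_le {c : ℝ} (hc : 0 < c) {L : ℕ → ℝ} (hL : ∀ i, l + i ≤ L i) :
    ∑' i, ENNReal.ofReal (Real.exp (-(c * L i)))
      ≤ ENNReal.ofReal (Real.exp (-(c * l)) * (1 - Real.exp (-c))⁻¹) := by
  have hsum := (hasSum_geometric_of_lt_one (Real.exp_pos (-c)).le
    (Real.exp_lt_one_iff.2 (neg_lt_zero.2 hc))).mul_left (Real.exp (-(c * l)))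
  rw [← hsum.tsum_eq, ENNReal.ofReal_tsum_of_nonneg (fun i => by positivity) hsum.summable]
  refine ENNReal.tsum_le_tsum fun i => ENNReal.ofReal_le_ofReal ?_
  rw [← Real.exp_nat_mul, ← Real.exp_add]
  refine Real.exp_le_exp.2 ?_
  nlinarith [hL i]

lemma tendsto_ofReal_exp_neg_mul_mul {c : ℝ} (hc : 0 < c) (C : ℝ) :
    Tendsto (fun l : ℝ => ENNReal.ofReal (Real.exp (-(c * l)) * C)) atTop (𝓝 0) := by
  have hexp : Tendsto (fun l : ℝ => Real.exp (-(c * l))) atTop (𝓝 0) :=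
    Real.tendsto_exp_neg_atTop_nhds_zero.comp (tendsto_id.const_mul_atTop hc)
  simpa using ENNReal.tendsto_ofReal (hexp.mul_const C)

end Orbit

lemma ae_of_eventually_measure_le {Ω ι : Type*} [MeasurableSpace Ω] {μ : Measure Ω}
    {l : Filter ι} [l.NeBot] {p : Ω → Prop} {b : ι → ENNReal} (hb : Tendsto b l (𝓝 0))
    (h : ∀ᶠ x in l, μ {ω | ¬ p ω} ≤ b x) : ∀ᵐ ω ∂μ, p ω :=
  ae_iff.2 (le_antisymm (ge_of_tendsto hb h) zero_le)

section HeightBounds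

variable {Ω : Type*} [MeasurableSpace Ω] {μ : Measure Ω} [IsProbabilityMeasure μ]
  {w : ℕ → ℝ} {T : Ω → GrowingTree} {aInf γ β c κ d x₀ : ℝ} {Ψ : ℝ → ℝ}

section UpperBound

/-- A given vertex has height `h + i` with probability at most `exp (-L i)`, and only
`exp (κ * L i)` labels compete. -/
lemma eventually_exists_measure_not_forall_floor_exp_lt_le (hT : IsWRT μ w T)
    (hw : ∀ n, 1 ≤ n → 0 ≤ w n) (hw1 : 0 < w 1) (ha : Tendsto (a w) atTop (𝓝 aInf))
    (hA : StretchedExpDecay (fun n => aInf - a w n) γ β) (hβ : 0 < β) (hc0 : 0 < c) (hc : c < γ)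
    (hκ0 : 0 < κ) (hκ : κ < 1) :
    ∀ᶠ l in atTop, ∃ h : ℕ, μ {ω | ¬ ∀ i v, 1 ≤ v → h + i ≤ (T ω).depth v →
        ⌊Real.exp (κ * orbit (fun L => c * (κ * L) ^ β) l i)⌋₊ < v}
      ≤ ENNReal.ofReal (Real.exp (-((1 - κ) * l)) * (1 - Real.exp (-(1 - κ)))⁻¹) := by
  have hscale : Tendsto (fun L : ℝ => κ * L) atTop atTop := tendsto_id.const_mul_atTop hκ0
  filter_upwards [
    eventually_forall_ge_atTop.2 (hscale.eventually (hA.eventually_floor_exp_le hc)),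
    eventually_forall_ge_atTop.2 ((tendsto_mul_rpow_atTop hc0 hκ0 hβ).eventually_ge_atTop 1)]
    with l htail hstep
  set L := orbit (fun L => c * (κ * L) ^ β) l
  obtain ⟨h, hh⟩ := exists_forall_measureReal_le_depth_le hT hw hw1 ha (Real.exp_pos (-l))
  have hsucc : ∀ i, Real.exp (-L i) * (aInf - a w ⌊Real.exp (κ * L i)⌋₊)
      ≤ Real.exp (-L (i + 1)) := fun i => by
    calc Real.exp (-L i) * (aInf - a w ⌊Real.exp (κ * L i)⌋₊)
        ≤ Real.exp (-L i) * Real.exp (-(c * (κ * L i) ^ β)) := by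
          gcongr
          exact htail _ (le_orbit hstep i)
      _ = Real.exp (-L (i + 1)) := by rw [← Real.exp_add, ← neg_add]; rfl
  refine ⟨h, (measure_not_forall_lt_of_le_depth_le hT hw hw1 ha
    (s := fun i => ⌊Real.exp (κ * L i)⌋₊) (fun i => (Real.exp_pos (-L i)).le) hh hsucc).trans
    (le_trans (ENNReal.tsum_le_tsum fun i => ENNReal.ofReal_le_ofReal ?_)
      (tsum_ofReal_exp_neg_mul_le (sub_pos.2 hκ) (add_le_orbit hstep)))⟩
  calc ⌊Real.exp (κ * L i)⌋₊ * Real.exp (-L i) ≤ Real.exp (κ * L i) * Real.exp (-L i) := by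
        gcongr
        exact Nat.floor_le (Real.exp_pos _).le
    _ = Real.exp (-((1 - κ) * L i)) := by rw [← Real.exp_add]; ring_nf

theorem ae_exists_eventually_height_le (hT : IsWRT μ w T) (hw : ∀ n, 1 ≤ n → 0 ≤ w n)
    (hw1 : 0 < w 1) (ha : Tendsto (a w) atTop (𝓝 aInf))
    (hA : StretchedExpDecay (fun n => aInf - a w n) γ β) (hβ : 0 < β)
    (hmono : StrictMonoOn Ψ (Set.Ici x₀)) (hlim : Tendsto Ψ atTop atTop) (hc0 : 0 < c)
    (hc : c < γ) (hκ0 : 0 < κ) (hκ : κ < 1) (hd : 0 < d)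
    (hinc : ∀ᶠ L in atTop, Ψ L + d ≤ Ψ (L + c * (κ * L) ^ β)) :
    ∀ᵐ ω ∂μ, ∃ C : ℝ, ∀ᶠ n : ℕ in atTop,
      ((T ω).height n : ℝ) ≤ C + Ψ (Real.log n / κ) / d := by
  refine ae_of_eventually_measure_le
    (tendsto_ofReal_exp_neg_mul_mul (sub_pos.2 hκ) (1 - Real.exp (-(1 - κ)))⁻¹) ?_
  filter_upwards [eventually_exists_measure_not_forall_floor_exp_lt_le hT hw hw1 ha hA hβ hc0 hc
      hκ0 hκ, eventually_forall_ge_atTop.2 hinc, eventually_ge_atTop x₀,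
    eventually_forall_ge_atTop.2 ((tendsto_mul_rpow_atTop hc0 hκ0 hβ).eventually_ge_atTop 1),
    hlim.eventually_ge_atTop 0] with l ⟨h, hmeasure⟩ hincrement hlx₀ hstep hΨl
  refine (measure_mono ?_).trans hmeasure
  intro ω hω hgood
  refine hω ⟨h + 1, ?_⟩
  have hscale : Tendsto (fun n : ℕ => Real.log n / κ) atTop atTop :=
    tendsto_log_natCast.atTop_div_const hκ0
  filter_upwards [hscale.eventually_ge_atTop x₀, (hlim.comp hscale).eventually_ge_atTop 0,
    eventually_ge_atTop 1] with n hnx₀ hΨn hn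
  have hreach := le_orbit_ceil_div hmono hlx₀ hnx₀ hd hstep hΨl hincrement
  have hceil := Nat.ceil_lt_add_one (div_nonneg hΨn hd.le)
  rw [Function.comp_apply] at hceil
  set i := ⌈Ψ (Real.log n / κ) / d⌉₊
  have hlabel : n ≤ ⌊Real.exp (κ * orbit (fun L => c * (κ * L) ^ β) l i)⌋₊ := by
    refine Nat.le_floor ?_
    rwa [← Real.log_le_iff_le_exp (by exact_mod_cast hn), ← div_le_iff₀' hκ0]
  have hheight : (T ω).height n ≤ h + i := by
    rw [GrowingTree.height_le_iff]
    intro v hv hvn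
    by_contra! hdepth
    exact absurd (hgood i v hv hdepth.le) (hvn.trans hlabel).not_gt
  have hheight' : ((T ω).height n : ℝ) ≤ h + i := by exact_mod_cast hheight
  linarith

end UpperBound

/-- The tail of `∑ (w i / W i) ^ 2` is polynomially smaller, by a factor `n ^ (-s)` with `s > θ`,
than the squared tail of `∑ w i / W i`. -/
def SqTailNegligible (w : ℕ → ℝ) (aInf θ : ℝ) : Prop :=
  ∃ s > θ, ∀ᶠ n : ℕ in atTop, sqTail w n ≤ (n : ℝ) ^ (-s) * (aInf - a w n) ^ 2

section LowerBound

lemma le_mul_sq_div_of_mul_le {L lg e A K v s : ℝ} {t : ℕ} (ht : 1 ≤ t) (hA : 0 < A)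
    (hlg : 0 < lg) (hK : 0 < K) (hv : 0 < v)
    (h : 8 * K ^ 2 / v ^ 2 * L * lg ^ 2 ≤ e * (t : ℝ) ^ s) :
    L ≤ e * (v * (A / lg)) ^ 2 / (8 * (K ^ 2 * ((t : ℝ) ^ (-s) * A ^ 2))) := by
  have ht0 : (0 : ℝ) < t := by exact_mod_cast ht
  rw [Real.rpow_neg ht0.le]
  calc L = 8 * K ^ 2 / v ^ 2 * L * lg ^ 2 * (v ^ 2 / (8 * K ^ 2 * lg ^ 2)) := by field_simp
    _ ≤ e * (t : ℝ) ^ s * (v ^ 2 / (8 * K ^ 2 * lg ^ 2)) := by gcongr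
    _ = _ := by field_simp

/-- The weight at height at least `j` among the labels up to `t j` is kept above
`exp (-L j) * K`. -/
lemma measure_not_forall_le_height_le_tsum_exp_neg (hT : IsWRT μ w T)
    (hw : ∀ n, 1 ≤ n → 0 ≤ w n) (hw1 : 0 < w 1) (ha : Tendsto (a w) atTop (𝓝 aInf)) {K s : ℝ}
    (hK0 : 0 < K) (hK : ∀ n, W w n ≤ K) {t : ℕ → ℕ} (htmono : Monotone t) (ht : 1 < t 0)
    {L : ℕ → ℝ} (hroot : Real.exp (-L 0) * K ≤ w 1) (hpos : ∀ j, 0 < aInf - a w (t j))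
    (hwindow : ∀ j, (aInf - a w (t j)) / Real.log (t j) ≤ a w (t (j + 1)) - a w (t j))
    (hmass : ∀ j, 2 * K / w 1 * Real.exp (-(L (j + 1) - L j))
      ≤ (aInf - a w (t j)) / Real.log (t j))
    (hsq : ∀ j, sqTail w (t j) ≤ (t j : ℝ) ^ (-s) * (aInf - a w (t j)) ^ 2)
    (hexponent : ∀ j, 8 * K ^ 2 / w 1 ^ 2 * L j * Real.log (t j) ^ 2
      ≤ Real.exp (-L j) * (t j : ℝ) ^ s) :
    μ {ω | ¬ ∀ j, j ≤ (T ω).height (t j)} ≤ ∑' j, ENNReal.ofReal (Real.exp (-L j)) := by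
  have ht1 : ∀ j, 1 < t j := fun j => ht.trans_le (htmono (Nat.zero_le j))
  have hlog : ∀ j, 0 < Real.log (t j) := fun j => Real.log_pos (by exact_mod_cast ht1 j)
  set M : ℕ → ℝ := fun j => w 1 * ((aInf - a w (t j)) / Real.log (t j))
  set S : ℕ → ℝ := fun j => K ^ 2 * ((t j : ℝ) ^ (-s) * (aInf - a w (t j)) ^ 2)
  have hM : ∀ j, M j ≤ ∑ i ∈ Finset.Ioc (t j) (t (j + 1)), w i := fun j =>
    (mul_le_mul_of_nonneg_left (hwindow j) hw1.le).trans
      (mul_a_sub_a_le hw hw1 (htmono j.le_succ))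
  have hS0 : ∀ j, 0 < S j := fun j => by
    have htj : (0 : ℝ) < t j := by exact_mod_cast zero_lt_one.trans (ht1 j)
    have hAj := hpos j
    positivity
  have hS : ∀ j, ∑ i ∈ Finset.Ioc (t j) (t (j + 1)), w i ^ 2 ≤ S j := fun j =>
    (sum_Ioc_sq_le hw hw1 ha hK (ht1 j).le _).trans
      (mul_le_mul_of_nonneg_left (hsq j) (sq_nonneg K))
  have hsucc : ∀ j, Real.exp (-L (j + 1)) * K ≤ Real.exp (-L j) * M j / 2 := fun j => by
    calc Real.exp (-L (j + 1)) * K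
        = Real.exp (-L j) * (w 1 * (2 * K / w 1 * Real.exp (-(L (j + 1) - L j)))) / 2 := by
          rw [show -L (j + 1) = -L j + -(L (j + 1) - L j) by ring, Real.exp_add]
          field_simp
      _ ≤ Real.exp (-L j) * M j / 2 := by
          gcongr
          exact mul_le_mul_of_nonneg_left (hmass j) hw1.le
  refine (measure_not_forall_le_height_le hT hw hw1 hK0 hK htmono ht.le
    (fun j => Real.exp_pos (-L j)) (hroot.trans (W_one w ▸ W_mono hw ht.le))
    (fun j => mul_nonneg hw1.le (div_nonneg (hpos j).le (hlog j).le)) hM hS0 hS hsucc).trans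
    (ENNReal.tsum_le_tsum fun j => ENNReal.ofReal_le_ofReal (Real.exp_le_exp.2 (neg_le_neg ?_)))
  exact le_mul_sq_div_of_mul_le (ht1 j).le (hpos j) (hlog j) hK0 hw1 (hexponent j)

lemma eventually_measure_not_forall_le_height_ceil_exp_le (hT : IsWRT μ w T)
    (hw : ∀ n, 1 ≤ n → 0 ≤ w n) (hw1 : 0 < w 1) (ha : Tendsto (a w) atTop (𝓝 aInf))
    (hA : StretchedExpDecay (fun n => aInf - a w n) γ β) (hβ : 0 < β) (hc0 : 0 < c) (hc : γ < c)
    (hκ : 1 ≤ κ) (hsq : SqTailNegligible w aInf κ⁻¹) :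
    ∀ᶠ l in atTop, μ {ω | ¬ ∀ j,
        j ≤ (T ω).height ⌈Real.exp (κ * orbit (fun L => c * (κ * L) ^ β) l j)⌉₊}
      ≤ ENNReal.ofReal (Real.exp (-(1 * l)) * (1 - Real.exp (-1))⁻¹) := by
  have hκ0 : 0 < κ := by linarith
  obtain ⟨K, hK0, hK⟩ := exists_W_le_of_tendsto_a hw hw1 ha
  obtain ⟨s, hs, hsq⟩ := hsq
  have hroot := Real.tendsto_exp_neg_atTop_nhds_zero.mul_const K
  rw [zero_mul] at hroot
  have hscale : Tendsto (fun L : ℝ => κ * L) atTop atTop := tendsto_id.const_mul_atTop hκ0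
  filter_upwards [
    eventually_forall_ge_atTop.2 (hscale.eventually (hA.eventually_le_ceil_exp hc)),
    eventually_forall_ge_atTop.2
      (hscale.eventually (hA.eventually_ceil_exp_div_log_le_sub hβ hc0)),
    eventually_forall_ge_atTop.2 (hscale.eventually
      (hA.eventually_const_mul_exp_le_ceil_exp_div_log hβ hc
        (show 0 ≤ 2 * K / w 1 by positivity))),
    eventually_forall_ge_atTop.2 (hscale.eventually (tendsto_ceil_exp.eventually hsq)),
    eventually_forall_ge_atTop.2
      (eventually_mul_sq_log_ceil_exp_le hκ0 hs (8 * K ^ 2 / w 1 ^ 2)),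
    eventually_forall_ge_atTop.2 ((tendsto_mul_rpow_atTop hc0 hκ0 hβ).eventually_ge_atTop 1),
    hroot.eventually_lt_const hw1, eventually_gt_atTop 0]
    with l hpos hwindow hmass hsquares hexponent hstep hrootl hl
  set L := orbit (fun L => c * (κ * L) ^ β) l
  have hLl : ∀ j, l ≤ L j := le_orbit hstep
  have hLsucc : ∀ j, L (j + 1) = L j + c * (κ * L j) ^ β := fun j => rfl
  have hreach : ∀ j, κ * L j + c * (κ * L j) ^ β ≤ κ * L (j + 1) := fun j => by
    rw [hLsucc]
    nlinarith [hstep _ (hLl j)]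
  have hmono : Monotone fun j => ⌈Real.exp (κ * L j)⌉₊ := fun i j hij => Nat.ceil_mono
    (Real.exp_le_exp.2 (mul_le_mul_of_nonneg_left (orbit_mono hstep hij) hκ0.le))
  have hstart : 1 < ⌈Real.exp (κ * L 0)⌉₊ :=
    Nat.lt_ceil.2 (by exact_mod_cast Real.one_lt_exp_iff.2 (mul_pos hκ0 hl))
  refine (measure_not_forall_le_height_le_tsum_exp_neg hT hw hw1 ha hK0 hK hmono hstart
    hrootl.le (fun j => (Real.exp_pos _).trans_le (hpos _ (hLl j)))
    (fun j => (hwindow _ (hLl j) _ (hreach j)).trans_eq (by ring))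
    (fun j => by rw [hLsucc, add_sub_cancel_left]; exact hmass _ (hLl j))
    (fun j => hsquares _ (hLl j)) (fun j => hexponent _ (hLl j))).trans ?_
  simpa only [one_mul] using tsum_ofReal_exp_neg_mul_le one_pos (add_le_orbit hstep)

theorem ae_exists_eventually_le_height (hT : IsWRT μ w T) (hw : ∀ n, 1 ≤ n → 0 ≤ w n)
    (hw1 : 0 < w 1) (ha : Tendsto (a w) atTop (𝓝 aInf))
    (hA : StretchedExpDecay (fun n => aInf - a w n) γ β) (hβ : 0 < β)
    (hmono : StrictMonoOn Ψ (Set.Ici x₀)) (hlim : Tendsto Ψ atTop atTop) (hc0 : 0 < c)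
    (hc : γ < c) (hκ : 1 ≤ κ) (hsq : SqTailNegligible w aInf κ⁻¹) (hd : 0 < d)
    (hinc : ∀ᶠ L in atTop, Ψ (L + c * (κ * L) ^ β) ≤ Ψ L + d) :
    ∀ᵐ ω ∂μ, ∃ C : ℝ, ∀ᶠ n : ℕ in atTop,
      Ψ (Real.log n / κ) / d - C ≤ ((T ω).height n : ℝ) := by
  have hκ0 : 0 < κ := by linarith
  refine ae_of_eventually_measure_le
    (tendsto_ofReal_exp_neg_mul_mul one_pos (1 - Real.exp (-1))⁻¹) ?_
  filter_upwards [eventually_measure_not_forall_le_height_ceil_exp_le hT hw hw1 ha hA hβ hc0 hc hκ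
      hsq, eventually_forall_ge_atTop.2 hinc, eventually_ge_atTop x₀,
    eventually_forall_ge_atTop.2 ((tendsto_mul_rpow_atTop hc0 hκ0 hβ).eventually_ge_atTop 1)]
    with l hmeasure hincrement hlx₀ hstep
  refine (measure_mono ?_).trans hmeasure
  intro ω hω hgood
  refine hω ⟨Ψ l / d + 1, ?_⟩
  have hscale : Tendsto (fun n : ℕ => Real.log n / κ) atTop atTop :=
    tendsto_log_natCast.atTop_div_const hκ0
  filter_upwards [hscale.eventually_ge_atTop x₀, (hlim.comp hscale).eventually_ge_atTop (Ψ l),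
    eventually_ge_atTop 1] with n hnx₀ hΨn hn
  have hreach := orbit_floor_div_le hmono hlx₀ hnx₀ hd hstep hΨn hincrement
  have hfloor := Nat.lt_floor_add_one ((Ψ (Real.log n / κ) - Ψ l) / d)
  set j := ⌊(Ψ (Real.log n / κ) - Ψ l) / d⌋₊
  have hlabel : ⌈Real.exp (κ * orbit (fun L => c * (κ * L) ^ β) l j)⌉₊ ≤ n := by
    refine Nat.ceil_le.2 ?_
    rwa [← Real.le_log_iff_exp_le (by exact_mod_cast hn), ← le_div_iff₀' hκ0]
  have hheight : (j : ℝ) ≤ (T ω).height n := by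
    exact_mod_cast (hgood j).trans ((T ω).height_mono hlabel)
  rw [sub_div] at hfloor
  linarith

end LowerBound

end HeightBounds

/-- `Ψ` counts the steps of the recursion `L ↦ L + γ L ^ β`: along `L ↦ L + c L ^ β` its increments
tend to `ρ c`, with `ρ γ = 1`. It is also regularly varying, `Ψ (k L) / Ψ L → σ k`, and so does not
see perturbations of `L` by factors close to `1`. -/
structure IsHeightScale (Ψ : ℝ → ℝ) (γ β : ℝ) (ρ σ : ℝ → ℝ) : Prop where
  strictMonoOn : ∃ x₀, StrictMonoOn Ψ (Set.Ici x₀)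
  tendsto : Tendsto Ψ atTop atTop
  increment : ∀ c, 0 < c → Tendsto (fun L => Ψ (L + c * L ^ β) - Ψ L) atTop (𝓝 (ρ c))
  scale : ∀ k, 0 < k → Tendsto (fun L => Ψ (k * L) / Ψ L) atTop (𝓝 (σ k))
  continuousAt_increment : ContinuousAt ρ γ
  increment_eq : ρ γ = 1
  continuousAt_scale : ContinuousAt σ 1
  scale_one : σ 1 = 1

section Scales

variable {γ β c k : ℝ}

lemma tendsto_rpow_add_sub_rpow (hc : 0 < c) (hβ : β < 1) :
    Tendsto (fun L : ℝ => (L + c * L ^ β) ^ (1 - β) - L ^ (1 - β)) atTop (𝓝 (c * (1 - β))) := by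
  have hderiv : HasDerivAt (fun x : ℝ => x ^ (1 - β)) (1 - β) 1 := by
    simpa using Real.hasDerivAt_rpow_const (x := 1) (p := 1 - β) (Or.inl one_ne_zero)
  have hstep : Tendsto (fun L : ℝ => c * L ^ (-(1 - β))) atTop (𝓝[≠] 0) := by
    refine tendsto_nhdsWithin_iff.2 ⟨?_, ?_⟩
    · simpa using (tendsto_rpow_neg_atTop (sub_pos.2 hβ)).const_mul c
    · filter_upwards [eventually_gt_atTop 0] with L hL
      exact (mul_pos hc (Real.rpow_pos_of_pos hL _)).ne'
  have hlim := ((hasDerivAt_iff_tendsto_slope_zero.1 hderiv).comp hstep).const_mul c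
  refine hlim.congr' ?_
  filter_upwards [eventually_gt_atTop 0] with L hL
  have hfactor : L + c * L ^ β = L * (1 + c * (L ^ (1 - β))⁻¹) := by
    rw [← Real.rpow_neg hL.le, mul_add, mul_one, mul_left_comm, mul_comm L,
      ← Real.rpow_add_one hL.ne']
    ring_nf
  rw [hfactor, Real.mul_rpow hL.le (by positivity)]
  simp only [Function.comp_apply, smul_eq_mul, Real.one_rpow, Real.rpow_neg hL.le]
  field_simp

lemma isHeightScale_rpow (hγ : 0 < γ) (hβ : β < 1) :
    IsHeightScale (fun L => L ^ (1 - β) / (γ * (1 - β))) γ β (fun c => c / γ)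
      (fun k => k ^ (1 - β)) where
  strictMonoOn := ⟨0, fun x hx y _ hxy => div_lt_div_of_pos_right
    (Real.rpow_lt_rpow hx hxy (sub_pos.2 hβ)) (mul_pos hγ (sub_pos.2 hβ))⟩
  tendsto := (tendsto_rpow_atTop (sub_pos.2 hβ)).atTop_div_const (mul_pos hγ (sub_pos.2 hβ))
  increment c hc := by
    have hβ' : 1 - β ≠ 0 := (sub_pos.2 hβ).ne'
    have hlim := (tendsto_rpow_add_sub_rpow hc hβ).div_const (γ * (1 - β))
    rw [mul_div_mul_right _ _ hβ'] at hlim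
    exact hlim.congr fun L => sub_div _ _ _
  scale k hk := by
    have hβ' : γ * (1 - β) ≠ 0 := (mul_pos hγ (sub_pos.2 hβ)).ne'
    refine tendsto_const_nhds.congr' ?_
    filter_upwards [eventually_gt_atTop 0] with L hL
    rw [Real.mul_rpow hk.le hL.le, div_div_div_cancel_right₀ hβ',
      mul_div_cancel_right₀ _ (Real.rpow_pos_of_pos hL _).ne']
  continuousAt_increment := by fun_prop
  increment_eq := div_self hγ.ne'
  continuousAt_scale := Real.continuousAt_rpow_const _ _ (Or.inl one_ne_zero)
  scale_one := Real.one_rpow _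

lemma tendsto_log_mul_div_log (hk : 0 < k) :
    Tendsto (fun L => Real.log (k * L) / Real.log L) atTop (𝓝 1) := by
  have hlim : Tendsto (fun L => Real.log k / Real.log L + 1) atTop (𝓝 (0 + 1)) :=
    (Real.tendsto_log_atTop.const_div_atTop _).add_const 1
  rw [zero_add] at hlim
  refine hlim.congr' ?_
  filter_upwards [eventually_gt_atTop 1] with L hL
  rw [Real.log_mul hk.ne' (by positivity), add_div, div_self (Real.log_pos hL).ne']

lemma isHeightScale_log (hγ : 0 < γ) :
    IsHeightScale (fun L => Real.log L / Real.log (1 + γ)) γ 1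
      (fun c => Real.log (1 + c) / Real.log (1 + γ)) (fun _ => 1) where
  strictMonoOn := ⟨1, fun x hx y _ hxy => div_lt_div_of_pos_right
    (Real.log_lt_log (zero_lt_one.trans_le hx) hxy) (Real.log_pos (by linarith))⟩
  tendsto := Real.tendsto_log_atTop.atTop_div_const (Real.log_pos (by linarith))
  increment c hc := by
    refine tendsto_const_nhds.congr' ?_
    filter_upwards [eventually_gt_atTop 0] with L hL
    rw [Real.rpow_one, ← one_add_mul, Real.log_mul (by positivity) hL.ne']
    ring
  scale k hk := (tendsto_log_mul_div_log hk).congr fun L =>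
    (div_div_div_cancel_right₀ (Real.log_pos (by linarith)).ne' _ _).symm
  continuousAt_increment :=
    (ContinuousAt.log (by fun_prop) (by positivity)).div_const _
  increment_eq := div_self (Real.log_pos (by linarith)).ne'
  continuousAt_scale := continuousAt_const
  scale_one := rfl

lemma tendsto_log_add_mul_rpow_div_log (hc : 0 < c) (hβ : 1 < β) :
    Tendsto (fun L : ℝ => Real.log (L + c * L ^ β) / Real.log L) atTop (𝓝 β) := by
  have harg : Tendsto (fun L : ℝ => c + L ^ (-(β - 1))) atTop (𝓝 (c + 0)) :=
    (tendsto_rpow_neg_atTop (sub_pos.2 hβ)).const_add c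
  rw [add_zero] at harg
  have hlim := (((Real.continuousAt_log hc.ne').tendsto.comp harg).div_atTop
    Real.tendsto_log_atTop).const_add β
  rw [add_zero] at hlim
  refine hlim.congr' ?_
  filter_upwards [eventually_gt_atTop 1] with L hL
  have hL0 : 0 < L := by linarith
  have hfactor : L + c * L ^ β = L ^ β * (c + L ^ (-(β - 1))) := by
    rw [mul_add, ← Real.rpow_add hL0, show β + -(β - 1) = 1 by ring, Real.rpow_one]
    ring
  rw [hfactor, Real.log_mul (by positivity) (by positivity), Real.log_rpow hL0, add_div,
    mul_div_cancel_right₀ _ (Real.log_pos hL).ne', Function.comp_apply]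

lemma tendsto_log_log_sub_log_log {u : ℝ → ℝ} {b : ℝ} (hu : Tendsto u atTop atTop) (hb : b ≠ 0)
    (hdiv : Tendsto (fun L => Real.log (u L) / Real.log L) atTop (𝓝 b)) :
    Tendsto (fun L => Real.log (Real.log (u L)) - Real.log (Real.log L)) atTop
      (𝓝 (Real.log b)) := by
  refine ((Real.continuousAt_log hb).tendsto.comp hdiv).congr' ?_
  filter_upwards [eventually_gt_atTop 1, hu.eventually_gt_atTop 1] with L hL huL
  exact Real.log_div (Real.log_pos huL).ne' (Real.log_pos hL).ne'

lemma tendsto_log_log : Tendsto (fun L => Real.log (Real.log L)) atTop atTop :=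
  Real.tendsto_log_atTop.comp Real.tendsto_log_atTop

lemma tendsto_log_log_mul_div_log_log (hk : 0 < k) :
    Tendsto (fun L => Real.log (Real.log (k * L)) / Real.log (Real.log L)) atTop (𝓝 1) := by
  have hdiff := tendsto_log_log_sub_log_log (tendsto_id.const_mul_atTop hk) one_ne_zero
    (tendsto_log_mul_div_log hk)
  have hlim := (hdiff.div_atTop tendsto_log_log).add_const 1
  rw [zero_add] at hlim
  refine hlim.congr' ?_
  filter_upwards [tendsto_log_log.eventually_gt_atTop 0] with L hL
  rw [sub_div, div_self hL.ne', sub_add_cancel, id]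

lemma isHeightScale_log_log (γ : ℝ) (hβ : 1 < β) :
    IsHeightScale (fun L => Real.log (Real.log L) / Real.log β) γ β (fun _ => 1) (fun _ => 1) where
  strictMonoOn := by
    refine ⟨Real.exp 1, fun x hx y _ hxy => div_lt_div_of_pos_right ?_ (Real.log_pos hβ)⟩
    have hx0 : 0 < x := (Real.exp_pos 1).trans_le hx
    have hlog : 1 ≤ Real.log x := (Real.le_log_iff_exp_le hx0).2 hx
    exact Real.log_lt_log (by linarith) (Real.log_lt_log hx0 hxy)
  tendsto := tendsto_log_log.atTop_div_const (Real.log_pos hβ)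
  increment c hc := by
    have hstep : Tendsto (fun L : ℝ => L + c * L ^ β) atTop atTop :=
      tendsto_id.atTop_add_atTop ((tendsto_rpow_atTop (by linarith)).const_mul_atTop hc)
    have hlim := (tendsto_log_log_sub_log_log hstep (by positivity)
      (tendsto_log_add_mul_rpow_div_log hc hβ)).div_const (Real.log β)
    rw [div_self (Real.log_pos hβ).ne'] at hlim
    exact hlim.congr fun L => sub_div _ _ _
  scale k hk := (tendsto_log_log_mul_div_log_log hk).congr fun L =>
    (div_div_div_cancel_right₀ (Real.log_pos hβ).ne' _ _).symm
  continuousAt_increment := continuousAt_const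
  increment_eq := rfl
  continuousAt_scale := continuousAt_const
  scale_one := rfl

end Scales

lemma isEquivalent_of_forall_bounds {f F : ℕ → ℝ} (hF : Tendsto F atTop atTop)
    (hlower : ∀ k : ℕ, ∃ C, ∀ᶠ n in atTop, (1 - 1 / (k + 2 : ℝ)) * F n - C ≤ f n)
    (hupper : ∀ k : ℕ, ∃ C, ∀ᶠ n in atTop, f n ≤ C + (1 + 1 / (k + 2 : ℝ)) * F n) :
    f ~[atTop] F := by
  refine isLittleO_iff.2 fun η hη => ?_
  obtain ⟨k, hk⟩ := exists_nat_one_div_lt (half_pos hη)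
  have hk' : 1 / (k + 2 : ℝ) ≤ η / 2 :=
    (one_div_le_one_div_of_le (by positivity) (by linarith)).trans hk.le
  obtain ⟨C₁, hC₁⟩ := hlower k
  obtain ⟨C₂, hC₂⟩ := hupper k
  filter_upwards [hC₁, hC₂, hF.eventually_ge_atTop (C₁ / (η / 2)),
    hF.eventually_ge_atTop (C₂ / (η / 2)), hF.eventually_ge_atTop 0] with n h₁ h₂ hF₁ hF₂ hF₀
  rw [div_le_iff₀' (by positivity)] at hF₁ hF₂
  have hslack : 1 / (k + 2 : ℝ) * F n ≤ η / 2 * F n := mul_le_mul_of_nonneg_right hk' hF₀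
  rw [Pi.sub_apply, Real.norm_eq_abs, Real.norm_of_nonneg hF₀, abs_le]
  constructor <;> linarith

section HeightScale

variable {Ω : Type*} [MeasurableSpace Ω] {μ : Measure Ω} [IsProbabilityMeasure μ]
  {w : ℕ → ℝ} {T : Ω → GrowingTree} {aInf γ β d q s : ℝ} {Ψ ρ σ : ℝ → ℝ}

namespace IsHeightScale

lemma tendsto_increment (hΨ : IsHeightScale Ψ γ β ρ σ) :
    Tendsto (fun k => ρ (k * γ * k ^ β)) (𝓝 1) (𝓝 1) := by
  have hpow : ContinuousAt (fun k : ℝ => k * γ * k ^ β) 1 :=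
    ContinuousAt.mul (by fun_prop) (Real.continuousAt_rpow_const _ _ (Or.inl one_ne_zero))
  have hlim := hΨ.continuousAt_increment.tendsto.comp (hpow.tendsto.trans (by simp))
  rwa [hΨ.increment_eq] at hlim

lemma tendsto_scale_inv (hΨ : IsHeightScale Ψ γ β ρ σ) :
    Tendsto (fun k => σ k⁻¹) (𝓝 1) (𝓝 1) := by
  have hlim := hΨ.continuousAt_scale.tendsto.comp
    ((continuousAt_inv₀ (one_ne_zero (α := ℝ))).tendsto.trans (by simp))
  rwa [hΨ.scale_one] at hlim

theorem ae_exists_eventually_height_le_mul (hΨ : IsHeightScale Ψ γ β ρ σ) (hT : IsWRT μ w T)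
    (hw : ∀ n, 1 ≤ n → 0 ≤ w n) (hw1 : 0 < w 1) (ha : Tendsto (a w) atTop (𝓝 aInf))
    (hA : StretchedExpDecay (fun n => aInf - a w n) γ β) (hγ : 0 < γ) (hβ : 0 < β) (hq : 1 < q) :
    ∀ᵐ ω ∂μ, ∃ C : ℝ, ∀ᶠ n : ℕ in atTop, ((T ω).height n : ℝ) ≤ C + q * Ψ (Real.log n) := by
  have hroot : 1 < √q := Real.lt_sqrt_of_sq_lt (by linarith)
  obtain ⟨k, ⟨hρ, hσ⟩, hk0, hk1⟩ : ∃ k, ((√q)⁻¹ < ρ (k * γ * k ^ β) ∧ σ k⁻¹ < √q) ∧ 0 < k ∧ k < 1 :=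
    ((((hΨ.tendsto_increment.eventually_const_lt (inv_lt_one_of_one_lt₀ hroot)).and
      (hΨ.tendsto_scale_inv.eventually_lt_const hroot)).filter_mono nhdsWithin_le_nhds).and
      (Ioo_mem_nhdsLT zero_lt_one)).exists
  have hinc : ∀ᶠ L in atTop, Ψ L + (√q)⁻¹ ≤ Ψ (L + k * γ * (k * L) ^ β) := by
    filter_upwards [(hΨ.increment (k * γ * k ^ β) (by positivity)).eventually_const_lt hρ,
      eventually_ge_atTop 0] with L hL hL0
    rw [Real.mul_rpow hk0.le hL0, ← mul_assoc]
    linarith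
  have hscale : ∀ᶠ L in atTop, Ψ (L / k) ≤ √q * Ψ L := by
    filter_upwards [(hΨ.scale k⁻¹ (by positivity)).eventually_lt_const hσ,
      hΨ.tendsto.eventually_gt_atTop 0] with L hL hL0
    rw [div_lt_iff₀ hL0, inv_mul_eq_div] at hL
    exact hL.le
  obtain ⟨x₀, hmono⟩ := hΨ.strictMonoOn
  filter_upwards [ae_exists_eventually_height_le hT hw hw1 ha hA hβ hmono hΨ.tendsto
    (mul_pos hk0 hγ) (mul_lt_of_lt_one_left hγ hk1) hk0 hk1 (by positivity) hinc] with ω ⟨C, hC⟩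
  refine ⟨C, ?_⟩
  filter_upwards [hC, tendsto_log_natCast.eventually hscale] with n hn hn'
  calc ((T ω).height n : ℝ) ≤ C + √q * Ψ (Real.log n / k) := by rwa [div_inv_eq_mul, mul_comm] at hn
    _ ≤ C + √q * (√q * Ψ (Real.log n)) := by gcongr
    _ = C + q * Ψ (Real.log n) := by rw [← mul_assoc, Real.mul_self_sqrt (by linarith)]

theorem ae_exists_eventually_mul_le_height (hΨ : IsHeightScale Ψ γ β ρ σ) (hT : IsWRT μ w T)
    (hw : ∀ n, 1 ≤ n → 0 ≤ w n) (hw1 : 0 < w 1) (ha : Tendsto (a w) atTop (𝓝 aInf))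
    (hA : StretchedExpDecay (fun n => aInf - a w n) γ β) (hγ : 0 < γ) (hβ : 0 < β)
    (hsq : ∀ d > 1, ∀ s < 1, ∃ c > γ, ∃ κ ≥ 1,
      SqTailNegligible w aInf κ⁻¹ ∧ ρ (c * κ ^ β) < d ∧ s < σ κ⁻¹)
    (hq0 : 0 < q) (hq1 : q < 1) :
    ∀ᵐ ω ∂μ, ∃ C : ℝ, ∀ᶠ n : ℕ in atTop, q * Ψ (Real.log n) - C ≤ ((T ω).height n : ℝ) := by
  have hroot0 : 0 < √q := Real.sqrt_pos.2 hq0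
  have hroot1 : √q < 1 := (Real.sqrt_lt_sqrt hq0.le hq1).trans_eq Real.sqrt_one
  obtain ⟨c, hc, κ, hκ, hnegl, hρ, hσ⟩ := hsq (√q)⁻¹ ((one_lt_inv₀ hroot0).2 hroot1) √q hroot1
  have hc0 : 0 < c := hγ.trans hc
  have hκ0 : 0 < κ := zero_lt_one.trans_le hκ
  have hinc : ∀ᶠ L in atTop, Ψ (L + c * (κ * L) ^ β) ≤ Ψ L + (√q)⁻¹ := by
    filter_upwards [(hΨ.increment (c * κ ^ β) (by positivity)).eventually_lt_const hρ,
      eventually_ge_atTop 0] with L hL hL0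
    rw [Real.mul_rpow hκ0.le hL0, ← mul_assoc]
    linarith
  have hscale : ∀ᶠ L in atTop, √q * Ψ L ≤ Ψ (L / κ) := by
    filter_upwards [(hΨ.scale κ⁻¹ (by positivity)).eventually_const_lt hσ,
      hΨ.tendsto.eventually_gt_atTop 0] with L hL hL0
    rw [lt_div_iff₀ hL0, inv_mul_eq_div] at hL
    exact hL.le
  obtain ⟨x₀, hmono⟩ := hΨ.strictMonoOn
  filter_upwards [ae_exists_eventually_le_height hT hw hw1 ha hA hβ hmono hΨ.tendsto hc0 hc hκ hnegl
    (inv_pos.2 hroot0) hinc] with ω ⟨C, hC⟩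
  refine ⟨C, ?_⟩
  filter_upwards [hC, tendsto_log_natCast.eventually hscale] with n hn hn'
  calc q * Ψ (Real.log n) - C = √q * (√q * Ψ (Real.log n)) - C := by
        rw [← mul_assoc, Real.mul_self_sqrt hq0.le]
    _ ≤ √q * Ψ (Real.log n / κ) - C := by gcongr
    _ ≤ (T ω).height n := by rwa [div_inv_eq_mul, mul_comm] at hn

theorem ae_height_isEquivalent (hΨ : IsHeightScale Ψ γ β ρ σ) (hT : IsWRT μ w T)
    (hw : ∀ n, 1 ≤ n → 0 ≤ w n) (hw1 : 0 < w 1) (ha : Tendsto (a w) atTop (𝓝 aInf))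
    (hA : StretchedExpDecay (fun n => aInf - a w n) γ β) (hγ : 0 < γ) (hβ : 0 < β)
    (hsq : ∀ d > 1, ∀ s < 1, ∃ c > γ, ∃ κ ≥ 1,
      SqTailNegligible w aInf κ⁻¹ ∧ ρ (c * κ ^ β) < d ∧ s < σ κ⁻¹) :
    ∀ᵐ ω ∂μ, (fun n : ℕ => ((T ω).height n : ℝ)) ~[atTop] fun n : ℕ => Ψ (Real.log n) := by
  have hlt (k : ℕ) : 1 / (k + 2 : ℝ) < 1 := by
    rw [div_lt_one (by positivity)]
    linarith [k.cast_nonneg (α := ℝ)]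
  have hlower (k : ℕ) := hΨ.ae_exists_eventually_mul_le_height hT hw hw1 ha hA hγ hβ hsq
    (q := 1 - 1 / (k + 2 : ℝ)) (sub_pos.2 (hlt k)) (sub_lt_self 1 (by positivity))
  have hupper (k : ℕ) := hΨ.ae_exists_eventually_height_le_mul hT hw hw1 ha hA hγ hβ
    (q := 1 + 1 / (k + 2 : ℝ)) (lt_add_of_pos_right 1 (by positivity))
  filter_upwards [ae_all_iff.2 hlower, ae_all_iff.2 hupper] with ω
  exact isEquivalent_of_forall_bounds (hΨ.tendsto.comp tendsto_log_natCast)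

lemma exists_sqTailNegligible_inv (hΨ : IsHeightScale Ψ γ β ρ σ) (hγ : 0 < γ)
    (hsq : ∀ θ < 1, SqTailNegligible w aInf θ) (hd : 1 < d) (hs : s < 1) :
    ∃ c > γ, ∃ κ ≥ 1, SqTailNegligible w aInf κ⁻¹ ∧ ρ (c * κ ^ β) < d ∧ s < σ κ⁻¹ := by
  obtain ⟨k, ⟨hρ, hσ⟩, hk⟩ : ∃ k, (ρ (k * γ * k ^ β) < d ∧ s < σ k⁻¹) ∧ 1 < k :=
    ((((hΨ.tendsto_increment.eventually_lt_const hd).and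
      (hΨ.tendsto_scale_inv.eventually_const_lt hs)).filter_mono nhdsWithin_le_nhds).and
      (self_mem_nhdsWithin (s := Set.Ioi 1))).exists
  exact ⟨k * γ, lt_mul_of_one_lt_left hγ hk, k, hk.le, hsq _ (inv_lt_one_of_one_lt₀ hk), hρ, hσ⟩

end IsHeightScale

end HeightScale

section SqTail

variable {w : ℕ → ℝ} {A : ℕ → ℝ} {aInf γ β e θ : ℝ}

lemma eventually_const_mul_rpow_le {s t : ℝ} (hst : s < t) (C : ℝ) :
    ∀ᶠ n : ℕ in atTop, C * (n : ℝ) ^ s ≤ (n : ℝ) ^ t := by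
  have hlim : Tendsto (fun n : ℕ => (n : ℝ) ^ (t - s)) atTop atTop :=
    (tendsto_rpow_atTop (sub_pos.2 hst)).comp tendsto_natCast_atTop_atTop
  filter_upwards [hlim.eventually_ge_atTop C, eventually_ge_atTop 1] with n hn hn1
  have hn0 : (0 : ℝ) < n := by exact_mod_cast hn1
  calc C * (n : ℝ) ^ s ≤ (n : ℝ) ^ (t - s) * (n : ℝ) ^ s := by gcongr
    _ = (n : ℝ) ^ t := by rw [← Real.rpow_add hn0, sub_add_cancel]

lemma sqTailNegligible_of_isBigO_mul_sq {B : ℕ → ℝ} {ε b : ℝ} (hb : 0 < b)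
    (hO : sqTail w =O[atTop] fun n : ℕ => (n : ℝ) ^ (-ε) * B n ^ 2)
    (hB : ∀ᶠ n : ℕ in atTop, 0 ≤ B n ∧ b * B n ≤ aInf - a w n) (hθ : θ < ε) :
    SqTailNegligible w aInf θ := by
  obtain ⟨s, hθs, hs⟩ := exists_between hθ
  obtain ⟨C, hC⟩ := hO.bound
  refine ⟨s, hθs, ?_⟩
  filter_upwards [hC, hB, eventually_const_mul_rpow_le (neg_lt_neg hs) (C / b ^ 2)]
    with n hn ⟨hB0, hBA⟩ hpow
  calc sqTail w n ≤ C * ((n : ℝ) ^ (-ε) * B n ^ 2) := by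
        rw [Real.norm_of_nonneg (by positivity : 0 ≤ (n : ℝ) ^ (-ε) * B n ^ 2)] at hn
        exact (le_abs_self _).trans hn
    _ = C / b ^ 2 * (n : ℝ) ^ (-ε) * (b * B n) ^ 2 := by field_simp
    _ ≤ (n : ℝ) ^ (-s) * (aInf - a w n) ^ 2 := by gcongr

lemma sqTailNegligible_of_isBigO_rpow {p : ℝ}
    (hO : sqTail w =O[atTop] fun n : ℕ => 1 / (n : ℝ) ^ p)
    (hA : ∀ᶠ n : ℕ in atTop, (n : ℝ) ^ (-e) ≤ aInf - a w n) (hθ : θ < p - 2 * e) :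
    SqTailNegligible w aInf θ := by
  refine sqTailNegligible_of_isBigO_mul_sq one_pos (hO.congr' .rfl ?_)
    (hA.mono fun n hn => ⟨by positivity, (one_mul _).trans_le hn⟩) hθ
  filter_upwards [eventually_gt_atTop 0] with n hn
  have hn0 : (0 : ℝ) < n := by exact_mod_cast hn
  rw [← Real.rpow_mul_natCast hn0.le, ← Real.rpow_add hn0, one_div, ← Real.rpow_neg hn0.le]
  push_cast
  ring_nf

lemma sqTailNegligible_of_isBigO_mainTerm {α ε : ℝ} {J : ℝ → ℝ} {r : ℕ → ℝ}
    (hJpos : ∀ x, 1 ≤ x → 0 < J x) (hr : Tendsto r atTop (𝓝 0))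
    (hA : ∀ᶠ n : ℕ in atTop, aInf - a w n = mainTerm α β J n * (1 + r n))
    (hO : sqTail w =O[atTop] fun n : ℕ => (n : ℝ) ^ (-ε) * mainTerm α β J n ^ 2) (hθ : θ < ε) :
    SqTailNegligible w aInf θ := by
  refine sqTailNegligible_of_isBigO_mul_sq one_half_pos hO ?_ hθ
  filter_upwards [hA, hr.eventually_const_lt (show (-(1 / 2) : ℝ) < 0 by norm_num)] with n hn hrn
  have hmain : 0 < mainTerm α β J n := by
    refine mul_pos (Real.exp_pos _) (hJpos _ (Real.one_le_exp ?_))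
    exact Real.rpow_nonneg (Real.log_natCast_nonneg n) β
  refine ⟨hmain.le, ?_⟩
  rw [hn, mul_comm]
  gcongr
  linarith

lemma StretchedExpDecay.eventually_rpow_neg_le (hA : StretchedExpDecay A γ 1) (he : γ < e) :
    ∀ᶠ n : ℕ in atTop, (n : ℝ) ^ (-e) ≤ A n := by
  filter_upwards [hA.lower e he, eventually_gt_atTop 0] with n hn hn0
  rwa [Real.rpow_def_of_pos (by exact_mod_cast hn0), mul_neg, mul_comm,
    ← Real.rpow_one (Real.log n)]

lemma StretchedExpDecay.eventually_rpow_neg_le_of_lt_one (hA : StretchedExpDecay A γ β)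
    (hβ : β < 1) (he : 0 < e) : ∀ᶠ n : ℕ in atTop, (n : ℝ) ^ (-e) ≤ A n := by
  have hlim : Tendsto (fun n : ℕ => e * Real.log n ^ (1 - β)) atTop atTop :=
    ((tendsto_rpow_atTop (sub_pos.2 hβ)).comp tendsto_log_natCast).const_mul_atTop he
  filter_upwards [hA.lower (γ + 1) (lt_add_one γ), hlim.eventually_ge_atTop (γ + 1),
    eventually_gt_atTop 0, tendsto_log_natCast.eventually_gt_atTop 0] with n hn hγ hn0 hlog
  refine le_trans ?_ hn
  rw [Real.rpow_def_of_pos (by exact_mod_cast hn0), mul_neg, Real.exp_le_exp, neg_le_neg_iff]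
  calc (γ + 1) * Real.log n ^ β ≤ e * Real.log n ^ (1 - β) * Real.log n ^ β := by gcongr
    _ = Real.log n * e := by
      rw [mul_assoc, ← Real.rpow_add hlog, sub_add_cancel, Real.rpow_one, mul_comm]

end SqTail

section Regimes

variable {Ω : Type*} [MeasurableSpace Ω] {μ : Measure Ω} [IsProbabilityMeasure μ]
  {w : ℕ → ℝ} {T : Ω → GrowingTree} {aInf γ β : ℝ}

theorem ae_height_isEquivalent_log_rpow (hT : IsWRT μ w T) (hw : ∀ n, 1 ≤ n → 0 ≤ w n)
    (hw1 : 0 < w 1) (ha : Tendsto (a w) atTop (𝓝 aInf))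
    (hA : StretchedExpDecay (fun n => aInf - a w n) γ β) (hγ : 0 < γ) (hβ : 0 < β) (hβ1 : β < 1)
    (hO : sqTail w =O[atTop] fun n : ℕ => 1 / (n : ℝ)) :
    ∀ᵐ ω ∂μ, (fun n : ℕ => ((T ω).height n : ℝ)) ~[atTop]
      fun n : ℕ => Real.log n ^ (1 - β) / (γ * (1 - β)) := by
  have hΨ := isHeightScale_rpow hγ hβ1
  have hsq : ∀ θ < 1, SqTailNegligible w aInf θ := fun θ hθ =>
    sqTailNegligible_of_isBigO_rpow (p := 1) (e := (1 - θ) / 4) (by simpa only [Real.rpow_one])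
      (hA.eventually_rpow_neg_le_of_lt_one hβ1 (by linarith)) (by linarith)
  exact hΨ.ae_height_isEquivalent hT hw hw1 ha hA hγ hβ fun d hd s hs =>
    hΨ.exists_sqTailNegligible_inv hγ hsq hd hs

theorem ae_height_isEquivalent_log_log (hT : IsWRT μ w T) (hw : ∀ n, 1 ≤ n → 0 ≤ w n)
    (hw1 : 0 < w 1) (ha : Tendsto (a w) atTop (𝓝 aInf))
    (hA : StretchedExpDecay (fun n => aInf - a w n) γ 1) (hγ : 0 < γ)
    (hO : ∀ ε : ℝ, 0 < ε → sqTail w =O[atTop] fun n : ℕ => 1 / (n : ℝ) ^ (2 * γ + 1 - ε)) :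
    ∀ᵐ ω ∂μ, (fun n : ℕ => ((T ω).height n : ℝ)) ~[atTop]
      fun n : ℕ => Real.log (Real.log n) / Real.log (1 + γ) := by
  have hΨ := isHeightScale_log hγ
  have hsq : ∀ θ < 1, SqTailNegligible w aInf θ := fun θ hθ =>
    sqTailNegligible_of_isBigO_rpow (e := γ + (1 - θ) / 4) (hO ((1 - θ) / 4) (by linarith))
      (hA.eventually_rpow_neg_le (by linarith)) (by linarith)
  exact hΨ.ae_height_isEquivalent hT hw hw1 ha hA hγ one_pos fun d hd s hs =>
    hΨ.exists_sqTailNegligible_inv hγ hsq hd hs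

theorem ae_height_isEquivalent_log_log_log (hT : IsWRT μ w T) (hw : ∀ n, 1 ≤ n → 0 ≤ w n)
    (hw1 : 0 < w 1) (ha : Tendsto (a w) atTop (𝓝 aInf))
    (hA : StretchedExpDecay (fun n => aInf - a w n) γ β) (hγ : 0 < γ) (hβ : 1 < β)
    {θ : ℝ} (hθ : 0 < θ) (hsq : ∀ θ' < θ, SqTailNegligible w aInf θ') :
    ∀ᵐ ω ∂μ, (fun n : ℕ => ((T ω).height n : ℝ)) ~[atTop]
      fun n : ℕ => Real.log (Real.log (Real.log n)) / Real.log β := by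
  refine (isHeightScale_log_log γ hβ).ae_height_isEquivalent hT hw hw1 ha hA hγ (by linarith)
    fun d hd s hs => ⟨γ + 1, lt_add_one γ, 1 + θ⁻¹, ?_, hsq _ ?_, hd, hs⟩
  · exact le_add_of_nonneg_right (by positivity)
  · exact inv_lt_of_inv_lt₀ hθ (lt_one_add _)

end Regimes

lemma SmoothlySlowlyVarying.of_le {k l : ℕ} {L : ℝ → ℝ} (hL : SmoothlySlowlyVarying l L)
    (hkl : k ≤ l) : SmoothlySlowlyVarying k L where
  differentiableOn i hi := hL.differentiableOn i (hi.trans_le hkl)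
  tendsto i h1 hi := hL.tendsto i h1 (hi.trans hkl)

lemma isBigO_log_rpow_of_le {s t : ℝ} (hst : s ≤ t) :
    (fun n : ℕ => Real.log n ^ s) =O[atTop] fun n : ℕ => Real.log n ^ t := by
  refine .of_bound' ?_
  filter_upwards [tendsto_log_natCast.eventually_ge_atTop 1] with n hn
  rw [Real.norm_of_nonneg (by positivity), Real.norm_of_nonneg (by positivity)]
  exact Real.rpow_le_rpow_of_exponent_le hn hst

end WRT

theorem theorem1p2_general {Ω : Type*} [MeasurableSpace Ω] (μ : Measure Ω) [IsProbabilityMeasure μ]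
    (w : ℕ → ℝ) (hw : ∀ n, 1 ≤ n → 0 ≤ w n) (hw1 : 0 < w 1)
    (T : Ω → GrowingTree) (hT : WRT.IsWRT μ w T)
    (α β : ℝ) (hα : 1 < α) (hβ : 0 < β)
    (J : ℝ → ℝ) (hJpos : ∀ x, 1 ≤ x → 0 < J x)
    (hJ1 : β < 1 / 2 → WRT.SmoothlySlowlyVarying 1 J)
    (hJ0 : 1 / 2 ≤ β → WRT.SlowlyVarying J)
    (aInf : ℝ) (ha : Tendsto (WRT.a w) atTop (𝓝 aInf))
    (r : ℕ → ℝ) (hr : r =o[atTop] fun n : ℕ => Real.log n ^ min (2 * β - 1) 0)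
    (hA : ∀ᶠ n : ℕ in atTop, aInf - WRT.a w n = WRT.mainTerm α β J n * (1 + r n)) :
    (β < 1 →
      WRT.sqTail w =O[atTop] (fun n : ℕ => 1 / (n : ℝ)) →
      ∀ᵐ ω ∂μ, (fun n : ℕ => ((T ω).height n : ℝ)) ~[atTop]
        fun n : ℕ => Real.log n ^ (1 - β) / ((α - 1) * (1 - β))) ∧
    (β = 1 →
      (∀ ε : ℝ, 0 < ε →
        WRT.sqTail w =O[atTop] (fun n : ℕ => 1 / (n : ℝ) ^ (2 * α - 1 - ε))) →
      ∀ᵐ ω ∂μ, (fun n : ℕ => ((T ω).height n : ℝ)) ~[atTop]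
        fun n : ℕ => Real.log (Real.log n) / Real.log α) ∧
    (1 < β →
      (∃ ε : ℝ, 0 < ε ∧
        WRT.sqTail w =O[atTop] (fun n : ℕ => 1 / (n : ℝ) ^ ε *
          Real.exp (-2 * (α - 1) * Real.log n ^ β) * J (Real.exp (Real.log n ^ β)) ^ 2)) →
      ∀ᵐ ω ∂μ, (fun n : ℕ => ((T ω).height n : ℝ)) ~[atTop]
        fun n : ℕ => Real.log (Real.log (Real.log n)) / Real.log β) := by
  have hγ : 0 < α - 1 := sub_pos.2 hα
  have hdecay := WRT.stretchedExpDecay_of_eq_mainTerm_mul hα hβ hJpos hJ1 hJ0 hr hA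
  refine ⟨fun hβ1 hO => ?_, fun hβ1 hO => ?_, fun hβ1 ⟨ε, hε, hO⟩ => ?_⟩
  · exact WRT.ae_height_isEquivalent_log_rpow hT hw hw1 ha hdecay hγ hβ hβ1 hO
  · subst hβ1
    have hexp (ε : ℝ) : 2 * (α - 1) + 1 - ε = 2 * α - 1 - ε := by ring
    simpa only [add_sub_cancel] using WRT.ae_height_isEquivalent_log_log hT hw hw1 ha hdecay hγ
      fun ε hε => by simpa only [hexp] using hO ε hε
  · have hr0 : Tendsto r atTop (𝓝 0) := by
      simpa only [min_eq_right (show 0 ≤ 2 * β - 1 by linarith), Real.rpow_zero,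
        isLittleO_one_iff] using hr
    refine WRT.ae_height_isEquivalent_log_log_log hT hw hw1 ha hdecay hγ hβ1 hε fun θ hθ =>
      WRT.sqTailNegligible_of_isBigO_mainTerm hJpos hr0 hA (hO.congr_right fun n => ?_) hθ
    rw [WRT.mainTerm, mul_pow, ← Real.exp_nat_mul, Real.rpow_neg n.cast_nonneg, one_div]
    push_cast
    ring_nf

theorem theorem1p2 {Ω : Type*} [MeasurableSpace Ω] (μ : Measure Ω) [IsProbabilityMeasure μ]
    (w : ℕ → ℝ) (hw : ∀ n, 1 ≤ n → 0 ≤ w n) (hw1 : 0 < w 1)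
    (T : Ω → GrowingTree) (hT : WRT.IsWRT μ w T)
    (α β : ℝ) (hα : 1 < α) (hβ : 0 < β)
    (J : ℝ → ℝ) (hJpos : ∀ x, 1 ≤ x → 0 < J x)
    (hJ2 : β < 1 / 2 → WRT.SmoothlySlowlyVarying 2 J)
    (hJ0 : 1 / 2 ≤ β → WRT.SlowlyVarying J)
    (ha : WRT.QuicklyConverging w α β J) :
    (β < 1 →
      WRT.sqTail w =O[atTop] (fun n : ℕ => 1 / (n : ℝ)) →
      ∀ᵐ ω ∂μ, (fun n : ℕ => ((T ω).height n : ℝ)) ~[atTop]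
        fun n : ℕ => Real.log n ^ (1 - β) / ((α - 1) * (1 - β))) ∧
    (β = 1 →
      (∀ ε : ℝ, 0 < ε →
        WRT.sqTail w =O[atTop] (fun n : ℕ => 1 / (n : ℝ) ^ (2 * α - 1 - ε))) →
      ∀ᵐ ω ∂μ, (fun n : ℕ => ((T ω).height n : ℝ)) ~[atTop]
        fun n : ℕ => Real.log (Real.log n) / Real.log α) ∧
    (1 < β →
      (∃ ε : ℝ, 0 < ε ∧
        WRT.sqTail w =O[atTop] (fun n : ℕ => 1 / (n : ℝ) ^ ε *
          Real.exp (-2 * (α - 1) * Real.log n ^ β) * J (Real.exp (Real.log n ^ β)) ^ 2)) →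
      ∀ᵐ ω ∂μ, (fun n : ℕ => ((T ω).height n : ℝ)) ~[atTop]
        fun n : ℕ => Real.log (Real.log (Real.log n)) / Real.log β) := by
  obtain ⟨aInf, ha, r, hr, hA⟩ := ha
  have hexp : min (4 * β - 2) 0 ≤ min (2 * β - 1) 0 := by grind
  exact theorem1p2_general μ w hw hw1 T hT α β hα hβ J hJpos (fun h => (hJ2 h).of_le one_le_two)
    hJ0 aInf ha r (hr.trans_isBigO (WRT.isBigO_log_rpow_of_le hexp))
    ((eventually_ge_atTop 1).mono hA)
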